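/- Let $V$ be a 3-dimensional complex vector space with a Hermitian form $\langle\cdot,\cdot\rangle$ (linear in the first argument) of signature $++-$. For a point $p\in\mathbb PV$ let $\sigma p\in\{-1,0,1\}$ be the sign of $\langle p,p\rangle$; $p$ is isotropic if $\sigma p=0$. Let $\mathrm{SU}(2,1)$ be the group of linear automorphisms of $V$ of determinant $1$ preserving the form. For a nonisotropic point $p$ and a unit complex number $\alpha$ with $\alpha^3\neq1$, let $R_\alpha^p\in\mathrm{SU}(2,1)$ be the special elliptic isometry $$R_\alpha^p x=(\alpha^{-2}-\alpha)\frac{\langle x,p\rangle}{\langle p,p\rangle}\,p+\alpha x .$$ For distinct $p_1,p_2\in\mathbb PV$ let $\mathrm L(p_1,p_2)$ be the complex projective line through them; it is Euclidean if the form restricted to the corresponding 2-dimensional subspace has signature $+0$. Bending subgroups. Let $p_1,p_2$ be distinct nonisotropic nonorthogonal points with $L:=\mathrm L(p_1,p_2)$ noneuclidean, let $\alpha_1,\alpha_2$ be unit complex numbers with $\alpha_i^3\ne1$, let $R:=R_{\alpha_2}^{p_2}R_{\alpha_1}^{p_1}$, and let $c$ be the polar point of $L$ (that is, $c$ is orthogonal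 to $L$). A bending subgroup of $R$ is a one-parameter subgroup $B:\mathbb R\to\mathrm{SU}(2,1)$ of the following form. (1) If $R$ is elliptic (it fixes a negative point): in an orthogonal basis $c,p,q$, with $p,q\in L$ fixed points of $R$, $B(s)=\mathrm{diag}(1,e^{is/2},e^{-is/2})$. (2) If $R$ is loxodromic (it fixes exactly two isotropic points $v_1,v_2$; these lie in $L$): in a basis $c,v_1,v_2$, $B(s)=\mathrm{diag}(1,e^{s},e^{-s})$. (3) If $R$ is parabolic (it fixes exactly one isotropic point $v_1$; it lies in $L$): in a basis $v_1,v_2,c$, where $v_2$ represents another isotropic point of $L$ and $\langle v_1,v_2\rangle\in\mathbb R$, $B(s)v_1=v_1$, $B(s)v_2=is\,v_1+v_2$, $B(s)c=c$. Theorem. Let $p_1,p_2$ and $q_1,q_2$ be pairs of distinct nonisotropic nonorthogonal points of $\mathbb PV$, and let $\alpha_1,\alpha_2$ be unit complex numbers with $\alpha_i^3\neq1$. Assume that $\mathrm L(p_1,p_2)$ is noneuclidean, that $\sigma p_i=\sigma q_i$ for $i=1,2$, and that $$R_{\alpha_2}^{p_2}R_{\alpha_1}^{p_1}=R_{\alpha_2}^{q_2}R_{\alpha_1}^{q_1}.$$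 Then $R:=R_{\alpha_2}^{p_2}R_{\alpha_1}^{p_1}$ has a bending subgroup, and for every bending subgroup $B$ of $R$, every $B(s)$ commutes with $R$ and there exists $s\in\mathbb R$ such that $B(s)p_1=q_1$ and $B(s)p_2=q_2$ in $\mathbb PV$. Thus every such relation is obtained from $R=R_{\alpha_2}^{p_2}R_{\alpha_1}^{p_1}$ by conjugating with an element of the bending subgroup. -/

import Mathlib

open scoped LinearAlgebra.Projectivization ComplexConjugate

namespace CHyp

variable {V : Type*} [AddCommGroup V] [Module ℂ V]

/-- `h x y` is the form `⟨x, y⟩`, linear in `x` and conjugate-linear in `y`. It is Hermitian of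
signature `++-` on the (three-dimensional) space `V`. -/
structure IsHermitianPPM (h : V →ₗ[ℂ] V →ₗ⋆[ℂ] ℂ) : Prop where
  conj_symm : ∀ x y, conj (h x y) = h y x
  signature : ∃ b : Module.Basis (Fin 3) ℂ V, ∀ i j, h (b i) (b j) =
    (Matrix.diagonal ![1, 1, -1] : Matrix (Fin 3) (Fin 3) ℂ) i j

/-- The group `SU(2,1)` of the form `h`: linear automorphisms of determinant `1` preserving `h`. -/
def SU (h : V →ₗ[ℂ] V →ₗ⋆[ℂ] ℂ) : Subgroup (V ≃ₗ[ℂ] V) where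
  carrier := {I | (∀ v w, h (I v) (I w) = h v w) ∧ LinearMap.det (I : V →ₗ[ℂ] V) = 1}
  mul_mem' := by
    rintro a b ⟨ha, ha'⟩ ⟨hb, hb'⟩
    refine ⟨fun v w => by rw [LinearEquiv.mul_apply, LinearEquiv.mul_apply, ha, hb], ?_⟩
    have : ((a * b : V ≃ₗ[ℂ] V) : V →ₗ[ℂ] V) = (a : V →ₗ[ℂ] V) * (b : V →ₗ[ℂ] V) := rfl
    rw [this, map_mul, ha', hb', one_mul]
  one_mem' := ⟨fun _ _ => rfl, LinearMap.det_id⟩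
  inv_mem' := by
    rintro a ⟨ha, ha'⟩
    refine ⟨fun v w => ?_, ?_⟩
    · have := ha (a⁻¹ v) (a⁻¹ w)
      rw [← LinearEquiv.mul_apply, ← LinearEquiv.mul_apply, mul_inv_cancel] at this
      exact this.symm
    · have e : (a : V →ₗ[ℂ] V) * ((a⁻¹ : V ≃ₗ[ℂ] V) : V →ₗ[ℂ] V) = 1 := by
        ext v
        exact a.apply_symm_apply v
      have := congrArg LinearMap.det e
      rwa [map_mul, ha', one_mul, map_one] at this

/-- The signature `σ p ∈ {-1, 0, 1}` of a point `p` of the projective plane. -/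
noncomputable def sigma (h : V →ₗ[ℂ] V →ₗ⋆[ℂ] ℂ) (p : ℙ ℂ V) : SignType :=
  SignType.sign (h p.rep p.rep).re

/-- Orthogonality of points of the projective plane. -/
def Orthogonal (h : V →ₗ[ℂ] V →ₗ⋆[ℂ] ℂ) (p q : ℙ ℂ V) : Prop :=
  h p.rep q.rep = 0

/-- The linear map `x ↦ (α⁻² - α) (⟨x, v⟩ / ⟨v, v⟩) v + α x`. -/
noncomputable def specialEllipticVec (h : V →ₗ[ℂ] V →ₗ⋆[ℂ] ℂ) (α : ℂ) (v : V) :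
    Module.End ℂ V :=
  (((α ^ 2)⁻¹ - α) / h v v) • (h.flip v).smulRight v + α • LinearMap.id

/-- The special elliptic isometry `R_α^p` with centre `p` and parameter `α`. -/
noncomputable def R (h : V →ₗ[ℂ] V →ₗ⋆[ℂ] ℂ) (α : Circle) (p : ℙ ℂ V) : Module.End ℂ V :=
  specialEllipticVec h α p.rep

theorem specialEllipticVec_apply (h : V →ₗ[ℂ] V →ₗ⋆[ℂ] ℂ) (α : ℂ) (v x : V) :
    specialEllipticVec h α v x = (((α ^ 2)⁻¹ - α) * (h x v / h v v)) • v + α • x := by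
  simp [specialEllipticVec, smul_smul]
  congr 1
  ring

/-- `R_α^p` does not depend on the representative of `p`. -/
theorem R_mk (h : V →ₗ[ℂ] V →ₗ⋆[ℂ] ℂ) (α : Circle) (v : V) (hv : v ≠ 0) :
    R h α (Projectivization.mk ℂ v hv) = specialEllipticVec h α v := by
  obtain ⟨a, ha⟩ := Projectivization.exists_smul_eq_mk_rep ℂ v hv
  ext x
  rw [R, ← ha, specialEllipticVec_apply, specialEllipticVec_apply]
  have h0 : (a : ℂ) ≠ 0 := a.ne_zero
  have h1 : conj (a : ℂ) ≠ 0 := by simp [h0]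
  simp only [Units.smul_def, map_smul, map_smulₛₗ, LinearMap.smul_apply, smul_eq_mul, smul_smul]
  congr 2
  by_cases hvv : h v v = 0
  · simp [hvv]
  · field_simp

/-- The two-dimensional subspace of `V` whose projectivization is the complex line `L(p₁, p₂)`
through the distinct points `p₁`, `p₂`. -/
noncomputable def line (p₁ p₂ : ℙ ℂ V) : Submodule ℂ V := p₁.submodule ⊔ p₂.submodule

/-- The projective line of a two-dimensional subspace `W` is Euclidean: the form restricted to `W`
has signature `+0`. -/
def IsEuclidean (h : V →ₗ[ℂ] V →ₗ⋆[ℂ] ℂ) (W : Submodule ℂ V) : Prop :=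
  ∃ e f : V, LinearIndependent ℂ ![e, f] ∧ Submodule.span ℂ {e, f} = W ∧
    h e e = 1 ∧ h e f = 0 ∧ h f f = 0

/-- The point `p` is fixed by `T`, that is, it is represented by an eigenvector of `T`. -/
def IsFixed (T : Module.End ℂ V) (p : ℙ ℂ V) : Prop :=
  ∃ μ : ℂ, T.HasEigenvector μ p.rep

/-- An isometry (not acting as the identity on the projective plane) is elliptic when it fixes a
negative point. -/
def IsElliptic (h : V →ₗ[ℂ] V →ₗ⋆[ℂ] ℂ) (T : Module.End ℂ V) : Prop :=
  (¬ ∃ μ : ℂ, T = μ • (1 : Module.End ℂ V)) ∧ ∃ p : ℙ ℂ V, sigma h p = -1 ∧ IsFixed T p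

/-- An isometry is loxodromic when it fixes exactly two isotropic points. -/
def IsLoxodromic (h : V →ₗ[ℂ] V →ₗ⋆[ℂ] ℂ) (T : Module.End ℂ V) : Prop :=
  {p : ℙ ℂ V | sigma h p = 0 ∧ IsFixed T p}.encard = 2

/-- An isometry is parabolic when it fixes exactly one isotropic point. -/
def IsParabolic (h : V →ₗ[ℂ] V →ₗ⋆[ℂ] ℂ) (T : Module.End ℂ V) : Prop :=
  {p : ℙ ℂ V | sigma h p = 0 ∧ IsFixed T p}.encard = 1

/-- `c` represents the polar point of the projective line of `W`. -/
def IsPolar (h : V →ₗ[ℂ] V →ₗ⋆[ℂ] ℂ) (W : Submodule ℂ V) (c : V) : Prop :=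
  c ≠ 0 ∧ ∀ w ∈ W, h w c = 0

/-- `B` is the one-parameter subgroup of bendings of `T = R_{α₂}^{p₂} R_{α₁}^{p₁}`, where `W` is the
two-dimensional subspace of the `T`-stable line `L(p₁, p₂)`. With `c` the polar point of the line:
* `T` elliptic: `B(s) = diag(1, e^{is/2}, e^{-is/2})` in an orthogonal basis `c, p, q`, where
  `p`, `q` are the fixed points of `T` in the line;
* `T` loxodromic: `B(s) = diag(1, e^s, e^{-s})` in a basis `c, v₁, v₂`, where `v₁`, `v₂` are the
  isotropic fixed points of `T`, which lie in the line;
* `T` parabolic: `B(s)` fixes `c` and `v₁` and sends `v₂` to `v₂ + i s v₁`, where `v₁` is the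
  isotropic fixed point of `T` and `v₂` is another isotropic point of the line (as `B(s)`
  preserves the form, `v₁`, `v₂` are normalized so that `⟨v₁, v₂⟩` is real).
The basis, hence `B` itself, is unique up to a change of scale `s ↦ k s` with `k ≠ 0` real. -/
def IsBendingGroup (h : V →ₗ[ℂ] V →ₗ⋆[ℂ] ℂ) (W : Submodule ℂ V) (T : Module.End ℂ V)
    (B : Multiplicative ℝ →* SU h) : Prop :=
  let b : ℝ → V ≃ₗ[ℂ] V := fun s => (B (Multiplicative.ofAdd s) : V ≃ₗ[ℂ] V)
  (IsElliptic h T ∧ ∃ c p q : V, LinearIndependent ℂ ![c, p, q] ∧ IsPolar h W c ∧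
    p ∈ W ∧ q ∈ W ∧ h p q = 0 ∧ (∃ μ, T.HasEigenvector μ p) ∧ (∃ μ, T.HasEigenvector μ q) ∧
    ∀ s : ℝ, b s c = c ∧ b s p = Complex.exp (s / 2 * Complex.I) • p ∧
      b s q = Complex.exp (-(s / 2 * Complex.I)) • q) ∨
  (IsLoxodromic h T ∧ ∃ c v₁ v₂ : V, LinearIndependent ℂ ![c, v₁, v₂] ∧ IsPolar h W c ∧
    v₁ ∈ W ∧ v₂ ∈ W ∧ h v₁ v₁ = 0 ∧ h v₂ v₂ = 0 ∧
    (∃ μ, T.HasEigenvector μ v₁) ∧ (∃ μ, T.HasEigenvector μ v₂) ∧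
    ∀ s : ℝ, b s c = c ∧ b s v₁ = Complex.exp s • v₁ ∧ b s v₂ = Complex.exp (-s) • v₂) ∨
  (IsParabolic h T ∧ ∃ v₁ v₂ c : V, LinearIndependent ℂ ![v₁, v₂, c] ∧ IsPolar h W c ∧
    v₁ ∈ W ∧ v₂ ∈ W ∧ h v₁ v₁ = 0 ∧ h v₂ v₂ = 0 ∧ (∃ μ, T.HasEigenvector μ v₁) ∧
    ∀ s : ℝ, b s v₁ = v₁ ∧ b s v₂ = ((s : ℂ) * Complex.I) • v₁ + v₂ ∧ b s c = c)

end CHyp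

namespace CHyp

/-! ### The Hermitian form of signature `++-` and special elliptic isometries. -/

section Form

variable {V : Type*} [AddCommGroup V] [Module ℂ V] {h : V →ₗ[ℂ] V →ₗ⋆[ℂ] ℂ}

/-! Write `T` for the product `R`, `W` for the plane of the line and `c` for its polar vector. As
`W` has trivial radical, `V = ℂ c ⊕ W` orthogonally, `T c = α₁α₂ c`, `T` preserves `W` and is not
scalar there (`isSplit_mul`). Moreover, an eigenvector of such a product with eigenvalue `α₁α₂` is
orthogonal to both centres (`orthogonal_of_mul_apply_eq`). Applied to `c` and the second
factorization, this puts `q₁` in `W`.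

The trace of `T` determines `⟨p₁,p₂⟩⟨p₂,p₁⟩ / (⟨p₁,p₁⟩⟨p₂,p₂⟩)`, and this quotient determines `⟨T
p₁,p₁⟩ / ⟨p₁,p₁⟩`. So, after rescaling `q₁` (which has the sign of `p₁`), the vectors `u = p₁` and
`w = q₁` of `W` agree in both `⟨u,u⟩` and `⟨T u,u⟩`. In the basis of `W` adapted to `T`, these two
numbers fix the coordinates `(x, y)` of `u` exactly up to bending and a common scalar: they fix
`|x|` and `|y|` in the elliptic case, `x ȳ` in the loxodromic case, `|y|` and `Re (x ȳ)` in the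
parabolic case. Hence some `B(s)` sends `p₁` to `q₁` (`commute_and_exists_bending`).

Since `B(s)` commutes with `T`, conjugating the first factorization gives another one of `T` with
first centre `q₁`. Cancelling the common factor leaves two special elliptic isometries with
parameter `α₂`, and `α₂³ ≠ 1` forces their centres `B(s) p₂` and `q₂` to coincide.

A bending subgroup exists because an eigenvector of `T` in `W` is either nonisotropic, giving an
orthogonal eigenbasis, or isotropic, giving two isotropic eigenvectors or a Jordan block
(`exists_bendingGroup`). -/

theorem form_smul_left (a : ℂ) (x y : V) : h (a • x) y = a * h x y := by simp

theorem form_smul_right (a : ℂ) (x y : V) : h x (a • y) = conj a * h x y := by simp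

theorem form_add_left (x x' y : V) : h (x + x') y = h x y + h x' y := by simp

theorem form_add_right (x y y' : V) : h x (y + y') = h x y + h x y' := by simp

theorem form_sub_left (x x' y : V) : h (x - x') y = h x y - h x' y := by simp

theorem form_sub_right (x y y' : V) : h x (y - y') = h x y - h x y' := by simp

namespace IsHermitianPPM

variable (hh : IsHermitianPPM h)
include hh

theorem eq_zero_comm {x y : V} (hxy : h x y = 0) : h y x = 0 := by
  rw [← hh.conj_symm, hxy, map_zero]

theorem self_im (x : V) : (h x x).im = 0 := Complex.conj_eq_iff_im.mp (hh.conj_symm x x)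

theorem ofReal_self_re (x : V) : (((h x x).re : ℝ) : ℂ) = h x x :=
  Complex.conj_eq_iff_re.mp (hh.conj_symm x x)

theorem finrank_eq : Module.finrank ℂ V = 3 := by
  obtain ⟨b, -⟩ := hh.signature
  simpa using Module.finrank_eq_card_basis b

theorem finiteDimensional : FiniteDimensional ℂ V := by
  obtain ⟨b, -⟩ := hh.signature
  exact b.finiteDimensional_of_finite

/-- The form in coordinates. -/
theorem exists_coords : ∃ b : Module.Basis (Fin 3) ℂ V, h (b 2) (b 2) = -1 ∧
    ∀ x y, h x y = b.repr x 0 * conj (b.repr y 0) + b.repr x 1 * conj (b.repr y 1)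
      - b.repr x 2 * conj (b.repr y 2) := by
  obtain ⟨b, hb⟩ := hh.signature
  refine ⟨b, by simp [hb], fun x y => ?_⟩
  conv_lhs => rw [← b.sum_repr x, ← b.sum_repr y]
  simp only [Fin.sum_univ_three, map_add, LinearMap.add_apply, form_smul_left, form_smul_right, hb]
  simp
  ring

theorem exists_neg : ∃ x, (h x x).re < 0 := by
  obtain ⟨b, hb, -⟩ := hh.exists_coords
  exact ⟨b 2, by simp [hb]⟩

theorem eq_zero_of_forall {x : V} (hx : ∀ y, h x y = 0) : x = 0 := by
  obtain ⟨b, hb⟩ := hh.signature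
  have key := fun j => hx (b j)
  rw [← b.sum_repr x] at key ⊢
  simp only [Fin.sum_univ_three, map_add, LinearMap.add_apply, form_smul_left, hb] at key ⊢
  have h0 := key 0
  have h1 := key 1
  have h2 := key 2
  simp at h0 h1 h2
  simp [h0, h1, h2]

/-- An isotropic vector orthogonal to a negative vector vanishes. -/
theorem eq_zero_of_orthogonal_neg {p w : V} (hp : (h p p).re < 0) (hw : h w w = 0)
    (hwp : h w p = 0) : w = 0 := by
  obtain ⟨b, -, hb⟩ := hh.exists_coords
  rw [hb] at hp hw hwp
  generalize b.repr p 0 = p0, b.repr p 1 = p1, b.repr p 2 = p2 at *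
  suffices b.repr w 0 = 0 ∧ b.repr w 1 = 0 ∧ b.repr w 2 = 0 by
    rw [← b.sum_repr w]
    simp only [Fin.sum_univ_three, this.1, this.2.1, this.2.2, zero_smul, add_zero]
  generalize b.repr w 0 = w0, b.repr w 1 = w1, b.repr w 2 = w2 at *
  have e1 : w0 * conj p0 + w1 * conj p1 = w2 * conj p2 := by linear_combination hwp
  -- Lagrange's identity on the positive coordinates. With `e3` and the strict inequality `e4` it
  -- forces `w2 = 0`.
  have e2 : (Complex.normSq w0 + Complex.normSq w1) * (Complex.normSq p0 + Complex.normSq p1)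
      = Complex.normSq w2 * Complex.normSq p2 + Complex.normSq (w0 * p1 - w1 * p0) := by
    rw [← Complex.normSq_conj p2, ← Complex.normSq_mul, ← e1]
    simp only [Complex.normSq_apply, Complex.add_re, Complex.add_im, Complex.sub_re, Complex.sub_im,
      Complex.mul_re, Complex.mul_im, Complex.conj_re, Complex.conj_im]
    ring
  have e3 : Complex.normSq w0 + Complex.normSq w1 = Complex.normSq w2 := by
    simp only [Complex.mul_conj] at hw
    have := sub_eq_zero.mp hw
    exact_mod_cast this
  have e4 : Complex.normSq p0 + Complex.normSq p1 < Complex.normSq p2 := by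
    simp only [Complex.mul_conj] at hp
    norm_cast at hp
    linarith
  have e5 : Complex.normSq w2 = 0 := by
    rw [e3] at e2
    have h1 := Complex.normSq_nonneg w2
    have h2 := Complex.normSq_nonneg (w0 * p1 - w1 * p0)
    by_contra h3
    have : 0 < Complex.normSq w2 := lt_of_le_of_ne h1 (Ne.symm h3)
    nlinarith
  have h0 := Complex.normSq_nonneg w0
  have h1 := Complex.normSq_nonneg w1
  refine ⟨?_, ?_, ?_⟩ <;> apply Complex.normSq_eq_zero.mp <;> linarith

/-- A vector orthogonal to the whole of a non-Euclidean line with a nonisotropic point vanishes. -/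
theorem eq_zero_of_not_isEuclidean {p₁ p₂ w : V} (hp : h p₁ p₁ ≠ 0)
    (hE : ¬ IsEuclidean h (Submodule.span ℂ {p₁, p₂})) (hw : w ∈ Submodule.span ℂ {p₁, p₂})
    (h₁ : h w p₁ = 0) (h₂ : h w p₂ = 0) : w = 0 := by
  obtain ⟨a, b, rfl⟩ := Submodule.mem_span_pair.mp hw
  set w := a • p₁ + b • p₂ with hwdef
  have hww : h w w = 0 := by
    conv_lhs => rw [hwdef]
    rw [form_add_left, form_smul_left, form_smul_left, hh.eq_zero_comm h₁, hh.eq_zero_comm h₂]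
    simp
  have him := hh.self_im p₁
  have hre : (h p₁ p₁).re ≠ 0 := fun h0 => hp (Complex.ext h0 him)
  rcases lt_or_gt_of_ne hre with hneg | hpos
  · exact hh.eq_zero_of_orthogonal_neg hneg hww h₁
  by_contra hw0
  have hb : b ≠ 0 := by
    rintro rfl
    rw [hwdef, zero_smul, add_zero, form_smul_left] at h₁
    apply hw0
    rw [hwdef, (mul_eq_zero.mp h₁).resolve_right hp]
    simp
  set r : ℝ := (h p₁ p₁).re with hr
  have hs : ((Real.sqrt r : ℝ) : ℂ) ≠ 0 := by
    exact_mod_cast (Real.sqrt_pos.mpr hpos).ne'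
  have hrr : ((Real.sqrt r : ℝ) : ℂ) * (Real.sqrt r : ℝ) = h p₁ p₁ := by
    rw [← hh.ofReal_self_re p₁, ← hr]
    exact_mod_cast Real.mul_self_sqrt hpos.le
  -- Here `p₁` is positive and a nonzero `w` would span the radical, so normalizing `p₁` would
  -- exhibit the signature `+0`.
  refine hE ⟨((Real.sqrt r : ℝ) : ℂ)⁻¹ • p₁, w, ?_, ?_, ?_, ?_, hww⟩
  · rw [LinearIndependent.pair_iff]
    intro s t hst
    have h3 := congrArg (fun x => h x p₁) hst
    simp only [form_add_left, form_smul_left, h₁, map_zero, LinearMap.zero_apply, mul_zero,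
      add_zero] at h3
    have hs0 : s = 0 := by
      rcases mul_eq_zero.mp h3 with h4 | h4
      · exact h4
      · exact absurd h4 (mul_ne_zero (inv_ne_zero hs) hp)
    subst hs0
    simpa [hw0] using hst
  · apply le_antisymm
    · rw [Submodule.span_le]
      rintro x (rfl | rfl)
      · exact Submodule.mem_span_pair.mpr ⟨((Real.sqrt r : ℝ) : ℂ)⁻¹, 0, by simp⟩
      · exact hw
    · rw [Submodule.span_le]
      rintro x (rfl | rfl)
      · exact Submodule.mem_span_pair.mpr ⟨(Real.sqrt r : ℝ), 0, by simp [smul_smul, hs]⟩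
      · refine Submodule.mem_span_pair.mpr ⟨-(b⁻¹ * a * (Real.sqrt r : ℝ)), b⁻¹, ?_⟩
        rw [hwdef, smul_smul, smul_add, smul_smul, smul_smul]
        match_scalars <;> field_simp
        ring
  · rw [form_smul_left, form_smul_right, map_inv₀, Complex.conj_ofReal, ← hrr]
    field_simp
  · rw [form_smul_left, hh.eq_zero_comm h₁, mul_zero]

theorem specialEllipticVec_isometry {α : ℂ} (hα : α * conj α = 1) {p : V} (hp : h p p ≠ 0)
    (x y : V) : h (specialEllipticVec h α p x) (specialEllipticVec h α p y) = h x y := by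
  have h0 : α ≠ 0 := left_ne_zero_of_mul_eq_one hα
  have h1 : conj α = α⁻¹ := eq_inv_of_mul_eq_one_right hα
  simp only [specialEllipticVec_apply, form_add_left, form_add_right, form_smul_left,
    form_smul_right, map_mul, map_sub, map_div₀, map_inv₀, map_pow, hh.conj_symm, h1]
  field_simp
  ring

end IsHermitianPPM

theorem specialEllipticVec_self (α : ℂ) {p : V} (hp : h p p ≠ 0) :
    specialEllipticVec h α p p = (α ^ 2)⁻¹ • p := by
  rw [specialEllipticVec_apply, div_self hp, ← add_smul]
  congr 1
  ring

theorem specialEllipticVec_of_orthogonal (α : ℂ) {p x : V} (hx : h x p = 0) :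
    specialEllipticVec h α p x = α • x := by
  rw [specialEllipticVec_apply, hx]
  simp

theorem circle_mul_conj (α : Circle) : (α : ℂ) * conj (α : ℂ) = 1 := by
  rw [Complex.mul_conj, Circle.normSq_coe, Complex.ofReal_one]

theorem inv_sq_sub_ne_zero {α : Circle} (hα : α ^ 3 ≠ 1) : ((α : ℂ) ^ 2)⁻¹ - α ≠ 0 := by
  intro h0
  apply hα
  apply Circle.ext
  have := α.coe_ne_zero
  field_simp at h0
  push_cast
  linear_combination -h0

end Form

/-! ### Products of two special elliptic isometries: splitting and trace. -/

section Pair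

variable {V : Type*} [AddCommGroup V] [Module ℂ V] {h : V →ₗ[ℂ] V →ₗ⋆[ℂ] ℂ}

/-- `T` is an isometry of `h` with the `γ`-eigenspace `ℂ c`, where `c` is nonisotropic with the
orthogonal complement `W`, and `T` does not act on `W` as a scalar. -/
structure IsSplit (h : V →ₗ[ℂ] V →ₗ⋆[ℂ] ℂ) (T : Module.End ℂ V) (W : Submodule ℂ V) (c : V)
    (γ : ℂ) : Prop where
  isometry : ∀ x y, h (T x) (T y) = h x y
  mem_iff : ∀ x, x ∈ W ↔ h x c = 0
  self_ne_zero : h c c ≠ 0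
  apply_eq : T c = γ • c
  orthogonal : ∀ x, T x = γ • x → ∀ w ∈ W, h x w = 0
  not_scalar : ¬ ∃ μ : ℂ, ∀ w ∈ W, T w = μ • w

/-- Each factor is a scalar plus a multiple of its centre, so the eigenvalue equation is a linear
relation between `p₁` and `p₂`. Independence kills both coefficients, which are nonzero multiples of
`⟨x, p₁⟩` and `⟨y, p₂⟩`, where `y` is the image of `x` under the first factor. -/
theorem orthogonal_of_mul_apply_eq {α₁ α₂ : Circle} (hα₁ : α₁ ^ 3 ≠ 1) (hα₂ : α₂ ^ 3 ≠ 1)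
    {p₁ p₂ x : V} (hp₁ : h p₁ p₁ ≠ 0) (hp₂ : h p₂ p₂ ≠ 0)
    (hp : LinearIndependent ℂ ![p₁, p₂])
    (hx : (specialEllipticVec h α₂ p₂ * specialEllipticVec h α₁ p₁) x = ((α₁ : ℂ) * α₂) • x) :
    h x p₁ = 0 ∧ h x p₂ = 0 := by
  have hβ₁ := inv_sq_sub_ne_zero hα₁
  have hβ₂ := inv_sq_sub_ne_zero hα₂
  rw [Module.End.mul_apply] at hx
  set y := specialEllipticVec h α₁ p₁ x with hy
  rw [specialEllipticVec_apply] at hx hy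
  rw [LinearIndependent.pair_iff] at hp
  have hrel := hp ((α₂ : ℂ) * ((((α₁ : ℂ) ^ 2)⁻¹ - α₁) * (h x p₁ / h p₁ p₁)))
    ((((α₂ : ℂ) ^ 2)⁻¹ - α₂) * (h y p₂ / h p₂ p₂)) (by
      have : (α₂ : ℂ) • y - (α₂ : ℂ) • (((((α₁ : ℂ) ^ 2)⁻¹ - α₁) * (h x p₁ / h p₁ p₁)) • p₁
        + (α₁ : ℂ) • x) = 0 := by rw [← hy, sub_self]
      rw [← sub_eq_zero] at hx
      linear_combination (norm := module) hx - this)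
  have h₁ : h x p₁ = 0 := by
    simpa [α₂.coe_ne_zero, hβ₁, hp₁] using hrel.1
  refine ⟨h₁, ?_⟩
  have hy₂ : h y p₂ = 0 := by simpa [hβ₂, hp₂] using hrel.2
  rw [hy, h₁] at hy₂
  simpa using hy₂

/-- Test on the component `w` of `p₂` orthogonal to `p₁`. The first factor scales `w`, and the
second adds a multiple of `p₂`, which `p₁` detects because `⟨p₂, p₁⟩ ≠ 0`. Scalarity would then put
`w` in the radical of the plane. -/
theorem mul_not_scalar {α₁ α₂ : Circle} (hα₂ : α₂ ^ 3 ≠ 1)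
    {p₁ p₂ : V} (hp₁ : h p₁ p₁ ≠ 0) (hp₂ : h p₂ p₂ ≠ 0)
    (hp : LinearIndependent ℂ ![p₁, p₂]) (hpo : h p₂ p₁ ≠ 0)
    (hW : ∀ w ∈ Submodule.span ℂ {p₁, p₂}, h w p₁ = 0 → h w p₂ = 0 → w = 0) :
    ¬ ∃ μ : ℂ, ∀ w ∈ Submodule.span ℂ {p₁, p₂},
      (specialEllipticVec h α₂ p₂ * specialEllipticVec h α₁ p₁) w = μ • w := by
  rintro ⟨μ, hμ⟩
  set w := p₂ - (h p₂ p₁ / h p₁ p₁) • p₁ with hw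
  have hwW : w ∈ Submodule.span ℂ {p₁, p₂} :=
    Submodule.mem_span_pair.mpr ⟨-(h p₂ p₁ / h p₁ p₁), 1, by rw [hw]; module⟩
  have hw₁ : h w p₁ = 0 := by
    rw [hw, form_sub_left, form_smul_left, div_mul_cancel₀ _ hp₁, sub_self]
  have hw0 : w ≠ 0 := by
    intro h0
    have := LinearIndependent.pair_iff.mp hp (-(h p₂ p₁ / h p₁ p₁)) 1 (by rw [← h0, hw]; module)
    exact one_ne_zero this.2
  have e := hμ w hwW
  rw [Module.End.mul_apply, specialEllipticVec_of_orthogonal _ hw₁, map_smul,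
    specialEllipticVec_apply] at e
  have e₁ := congrArg (fun x => h x p₁) e
  simp only [form_smul_left, form_add_left, hw₁, mul_zero, add_zero] at e₁
  have : h w p₂ = 0 := by
    simpa [α₁.coe_ne_zero, inv_sq_sub_ne_zero hα₂, hp₂, hpo] using e₁
  exact hw0 (hW w hwW hw₁ this)

theorem exists_orthogonal (hh : IsHermitianPPM h) (p₁ p₂ : V) :
    ∃ c, c ≠ 0 ∧ h c p₁ = 0 ∧ h c p₂ = 0 := by
  have := hh.finiteDimensional
  have hlt : Module.finrank ℂ (ℂ × ℂ) < Module.finrank ℂ V := by simp [hh.finrank_eq]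
  have hker := LinearMap.ker_ne_bot_of_finrank_lt (f := (h.flip p₁).prod (h.flip p₂)) hlt
  obtain ⟨c, hc, hc0⟩ := Submodule.exists_mem_ne_zero_of_ne_bot hker
  rw [LinearMap.mem_ker] at hc
  exact ⟨c, hc0, congrArg Prod.fst hc, congrArg Prod.snd hc⟩

/-- Being noneuclidean matters only through the trivial radical `hW`: it keeps `c` outside the
plane, so `c, p₁, p₂` is a basis, and then `c` is nonisotropic by nondegeneracy of the form. -/
theorem isSplit_mul (hh : IsHermitianPPM h) {α₁ α₂ : Circle} (hα₁ : α₁ ^ 3 ≠ 1)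
    (hα₂ : α₂ ^ 3 ≠ 1) {p₁ p₂ : V} (hp₁ : h p₁ p₁ ≠ 0) (hp₂ : h p₂ p₂ ≠ 0)
    (hp : LinearIndependent ℂ ![p₁, p₂]) (hpo : h p₂ p₁ ≠ 0)
    (hE : ¬ IsEuclidean h (Submodule.span ℂ {p₁, p₂})) :
    ∃ c, IsSplit h (specialEllipticVec h α₂ p₂ * specialEllipticVec h α₁ p₁)
      (Submodule.span ℂ {p₁, p₂}) c ((α₁ : ℂ) * α₂) := by
  have hW := fun w hw => hh.eq_zero_of_not_isEuclidean (w := w) hp₁ hE hw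
  obtain ⟨c, hc0, hc₁, hc₂⟩ := exists_orthogonal hh p₁ p₂
  have hcW : ∀ w ∈ Submodule.span ℂ {p₁, p₂}, h w c = 0 := by
    intro w hw
    obtain ⟨a, b, rfl⟩ := Submodule.mem_span_pair.mp hw
    simp [hh.eq_zero_comm hc₁, hh.eq_zero_comm hc₂]
  have hind : LinearIndependent ℂ ![c, p₁, p₂] := by
    refine linearIndependent_finCons.mpr ⟨hp, fun hc => hc0 (hW c ?_ hc₁ hc₂)⟩
    simpa [Set.pair_comm] using hc
  have hspan : ∀ x, ∃ t : ℂ, ∃ w ∈ Submodule.span ℂ {p₁, p₂}, x = t • c + w := by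
    have := hh.finiteDimensional
    intro x
    let b := basisOfLinearIndependentOfCardEqFinrank hind (by simp [hh.finrank_eq])
    refine ⟨b.repr x 0, b.repr x 1 • p₁ + b.repr x 2 • p₂,
      Submodule.mem_span_pair.mpr ⟨_, _, rfl⟩, ?_⟩
    conv_lhs => rw [← b.sum_repr x]
    simp [Fin.sum_univ_three, b, add_assoc]
  have hcc : h c c ≠ 0 := by
    intro h0
    refine hc0 (hh.eq_zero_of_forall fun y => hh.eq_zero_comm ?_)
    obtain ⟨t, w, hw, rfl⟩ := hspan y
    rw [form_add_left, form_smul_left, h0, hcW w hw]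
    simp
  refine ⟨c, ?_, ?_, hcc, ?_, ?_, mul_not_scalar hα₂ hp₁ hp₂ hp hpo hW⟩
  · intro x y
    rw [Module.End.mul_apply, Module.End.mul_apply,
      hh.specialEllipticVec_isometry (circle_mul_conj α₂) hp₂,
      hh.specialEllipticVec_isometry (circle_mul_conj α₁) hp₁]
  · intro x
    refine ⟨hcW x, fun hx => ?_⟩
    obtain ⟨t, w, hw, rfl⟩ := hspan x
    rw [form_add_left, form_smul_left, hcW w hw, add_zero] at hx
    rw [(mul_eq_zero.mp hx).resolve_right hcc]
    simpa using hw
  · rw [Module.End.mul_apply, specialEllipticVec_of_orthogonal _ hc₁, map_smul,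
      specialEllipticVec_of_orthogonal _ hc₂, smul_smul]
  · intro x hx w hw
    obtain ⟨h₁, h₂⟩ := orthogonal_of_mul_apply_eq hα₁ hα₂ hp₁ hp₂ hp hx
    obtain ⟨a, b, rfl⟩ := Submodule.mem_span_pair.mp hw
    simp [h₁, h₂]

/-- The product is `α₁α₂` times the identity plus maps of rank at most one. The points enter its
trace only through one quotient, which the trace therefore determines when the coefficient is
nonzero. -/
theorem trace_specialEllipticVec_mul (hh : IsHermitianPPM h) (α₁ α₂ : ℂ) {p₁ p₂ : V}
    (hp₁ : h p₁ p₁ ≠ 0) (hp₂ : h p₂ p₂ ≠ 0) :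
    LinearMap.trace ℂ V (specialEllipticVec h α₂ p₂ * specialEllipticVec h α₁ p₁) =
      ((α₂ ^ 2)⁻¹ - α₂) * ((α₁ ^ 2)⁻¹ - α₁) * (h p₁ p₂ * h p₂ p₁ / (h p₁ p₁ * h p₂ p₂))
        + α₂ * ((α₁ ^ 2)⁻¹ - α₁) + α₁ * ((α₂ ^ 2)⁻¹ - α₂) + 3 * α₁ * α₂ := by
  have := hh.finiteDimensional
  have e : specialEllipticVec h α₂ p₂ * specialEllipticVec h α₁ p₁ =
      (h.flip p₁).smulRight (((((α₁ ^ 2)⁻¹ - α₁) / h p₁ p₁) * (((α₂ ^ 2)⁻¹ - α₂) / h p₂ p₂)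
        * h p₁ p₂) • p₂) + (h.flip p₁).smulRight ((α₂ * ((α₁ ^ 2)⁻¹ - α₁) / h p₁ p₁) • p₁)
      + (h.flip p₂).smulRight ((α₁ * ((α₂ ^ 2)⁻¹ - α₂) / h p₂ p₂) • p₂)
      + (α₁ * α₂) • (1 : Module.End ℂ V) := by
    ext x
    simp only [Module.End.mul_apply, specialEllipticVec_apply, form_add_left, form_smul_left,
      LinearMap.add_apply, LinearMap.smulRight_apply, LinearMap.flip_apply, LinearMap.smul_apply,
      Module.End.one_apply]
    module
  rw [e]
  simp only [map_add, map_smul, LinearMap.trace_smulRight, LinearMap.flip_apply,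
    LinearMap.trace_one, hh.finrank_eq, smul_eq_mul]
  field_simp
  push_cast
  ring

theorem form_mul_apply_self (α₁ α₂ : ℂ) {p₁ p₂ : V} (hp₁ : h p₁ p₁ ≠ 0) :
    h ((specialEllipticVec h α₂ p₂ * specialEllipticVec h α₁ p₁) p₁) p₁ = (α₁ ^ 2)⁻¹ *
      (((α₂ ^ 2)⁻¹ - α₂) * (h p₁ p₂ * h p₂ p₁ / (h p₁ p₁ * h p₂ p₂)) + α₂) * h p₁ p₁ := by
  rw [Module.End.mul_apply, specialEllipticVec_self _ hp₁, map_smul, specialEllipticVec_apply,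
    form_smul_left, form_add_left, form_smul_left, form_smul_left]
  field_simp

/-- The quotient `⟨T p₁, p₁⟩ / ⟨p₁, p₁⟩` is determined by the product `T`. -/
theorem form_mul_apply_self_eq (hh : IsHermitianPPM h) {α₁ α₂ : Circle} (hα₁ : α₁ ^ 3 ≠ 1)
    (hα₂ : α₂ ^ 3 ≠ 1) {p₁ p₂ q₁ q₂ : V} (hp₁ : h p₁ p₁ ≠ 0) (hp₂ : h p₂ p₂ ≠ 0)
    (hq₁ : h q₁ q₁ ≠ 0) (hq₂ : h q₂ q₂ ≠ 0) {T : Module.End ℂ V}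
    (hp : T = specialEllipticVec h α₂ p₂ * specialEllipticVec h α₁ p₁)
    (hq : T = specialEllipticVec h α₂ q₂ * specialEllipticVec h α₁ q₁) :
    h (T p₁) p₁ * h q₁ q₁ = h (T q₁) q₁ * h p₁ p₁ := by
  have ht := trace_specialEllipticVec_mul hh α₁ α₂ hp₁ hp₂
  rw [← hp, hq, trace_specialEllipticVec_mul hh α₁ α₂ hq₁ hq₂] at ht
  have hne := mul_ne_zero (inv_sq_sub_ne_zero hα₂) (inv_sq_sub_ne_zero hα₁)
  -- The trace is affine in this quotient with the nonzero slope of `hne`.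
  have hta : h q₁ q₂ * h q₂ q₁ / (h q₁ q₁ * h q₂ q₂) = h p₁ p₂ * h p₂ p₁ / (h p₁ p₁ * h p₂ p₂) :=
    mul_left_cancel₀ hne (by linear_combination ht)
  conv_rhs => rw [hq]
  conv_lhs => rw [hp]
  rw [form_mul_apply_self _ _ hp₁, form_mul_apply_self _ _ hq₁, hta]
  ring

end Pair

/-! ### The three bending actions on coordinate pairs, up to a common scalar. -/

section Coordinates

theorem exists_exp_mul_of_normSq_eq {x x' : ℂ} (hx : Complex.normSq x = Complex.normSq x') :
    ∃ a : ℝ, x' = Complex.exp (a * Complex.I) * x := by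
  by_cases h0 : x = 0
  · subst h0
    have : x' = 0 := Complex.normSq_eq_zero.mp (by simpa using hx.symm)
    exact ⟨0, by simp [this]⟩
  refine ⟨Complex.arg (x' / x), ?_⟩
  have hn : ‖x' / x‖ = 1 := by
    have : ‖x‖ = ‖x'‖ := by simpa [Complex.normSq_eq_norm_sq] using hx
    rw [norm_div, this, div_self]
    rwa [← this, norm_ne_zero_iff]
  have := Complex.norm_mul_exp_arg_mul_I (x' / x)
  rw [hn, Complex.ofReal_one, one_mul] at this
  rw [this, div_mul_cancel₀ _ h0]

/-- If `x` and `y` turn by angles `a` and `b`, the half-sum is absorbed by `z` and the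
half-difference is the bending. -/
theorem exists_phases {x y x' y' : ℂ} (hx : Complex.normSq x = Complex.normSq x')
    (hy : Complex.normSq y = Complex.normSq y') :
    ∃ (s : ℝ) (z : ℂ), x' = z * (Complex.exp (s / 2 * Complex.I) * x) ∧
      y' = z * (Complex.exp (-(s / 2 * Complex.I)) * y) := by
  obtain ⟨a, rfl⟩ := exists_exp_mul_of_normSq_eq hx
  obtain ⟨b, rfl⟩ := exists_exp_mul_of_normSq_eq hy
  refine ⟨a - b, Complex.exp ((a + b) / 2 * Complex.I), ?_, ?_⟩ <;>
    rw [← mul_assoc, ← Complex.exp_add] <;> congr 2 <;> push_cast <;> ring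

/-- Take `e^s = |x'/x|` and let `z` be the phase of `x'/x`; the equality of the products then forces
`y'`. -/
theorem exists_scales {x y x' y' : ℂ} (hxy : x * conj y = x' * conj y') (h0 : x * conj y ≠ 0) :
    ∃ (s : ℝ) (z : ℂ), x' = z * (Complex.exp s * x) ∧ y' = z * (Complex.exp (-s) * y) := by
  have hx : x ≠ 0 := left_ne_zero_of_mul h0
  have hx' : x' ≠ 0 := left_ne_zero_of_mul (hxy ▸ h0)
  have hρ : 0 < ‖x' / x‖ := norm_pos_iff.mpr (div_ne_zero hx' hx)
  set r := ‖x' / x‖ with hr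
  have hr0 : (r : ℂ) ≠ 0 := by exact_mod_cast hρ.ne'
  have he : Complex.exp (Real.log r : ℝ) = r := by
    rw [← Complex.ofReal_exp, Real.exp_log hρ]
  refine ⟨Real.log r, x' / x / r, ?_, ?_⟩
  · rw [he]
    field_simp
  · rw [Complex.exp_neg, he]
    have h1 : (r : ℂ) * r = x' / x * conj (x' / x) := by
      rw [Complex.mul_conj, Complex.normSq_eq_norm_sq, ← hr]
      push_cast
      ring
    have h2 : conj x * y = conj x' * y' := by
      have := congrArg conj hxy
      simpa using this
    have hcx : conj x ≠ 0 := by simpa using hx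
    have hcx' : conj x' ≠ 0 := by simpa using hx'
    rw [map_div₀] at h1
    have h3 : x' / x / r * ((r : ℂ)⁻¹ * y) = x' / x * y / (r * r) := by field_simp
    rw [h3, h1]
    field_simp
    linear_combination -h2

/-- The scalar is `z = y'/y`, of modulus one. Equal real parts make `x' ȳ' - x ȳ` equal to `i t`
with `t` real, and `s = t / |y|²`. -/
theorem exists_shear {x y x' y' : ℂ} (hy : Complex.normSq y = Complex.normSq y') (hy0 : y ≠ 0)
    (hre : x * conj y + y * conj x = x' * conj y' + y' * conj x') :
    ∃ (s : ℝ) (z : ℂ), x' = z * (x + s * Complex.I * y) ∧ y' = z * y := by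
  have hn : ((Complex.normSq y : ℝ) : ℂ) ≠ 0 := by simpa using hy0
  have hcy : conj y ≠ 0 := by simpa using hy0
  have hy0' : y' ≠ 0 := by
    rw [← Complex.normSq_pos, ← hy, Complex.normSq_pos]
    exact hy0
  have hcy' : conj y' ≠ 0 := by simpa using hy0'
  have e1 := Complex.mul_conj y
  have e2 := Complex.mul_conj y'
  rw [← hy, ← e1] at e2
  have him : ∃ t : ℝ, x' * conj y' - x * conj y = t * Complex.I := by
    refine ⟨(x' * conj y' - x * conj y).im, Complex.ext ?_ (by simp)⟩
    have := congrArg Complex.re hre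
    simp only [Complex.add_re, Complex.mul_re, Complex.conj_re, Complex.conj_im] at this
    simp
    linarith
  obtain ⟨t, ht⟩ := him
  refine ⟨t / Complex.normSq y, y' / y, ?_, by field_simp⟩
  rw [Complex.ofReal_div, ← e1]
  have h3 : (t : ℂ) / (y * conj y) * Complex.I = (x' * conj y' - x * conj y) / (y * conj y) := by
    rw [ht]
    ring
  rw [h3]
  field_simp
  linear_combination -x' * e2

end Coordinates

/-! ### The action of `T` on the plane `W`, and transitivity of bendings by type. -/

section Split

variable {V : Type*} [AddCommGroup V] [Module ℂ V] {h : V →ₗ[ℂ] V →ₗ⋆[ℂ] ℂ}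

theorem IsHermitianPPM.exists_basis (hh : IsHermitianPPM h) {c p q : V}
    (hind : LinearIndependent ℂ ![c, p, q]) :
    ∃ b : Module.Basis (Fin 3) ℂ V, b 0 = c ∧ b 1 = p ∧ b 2 = q := by
  have := hh.finiteDimensional
  exact ⟨basisOfLinearIndependentOfCardEqFinrank hind (by simp [hh.finrank_eq]), by simp, by simp,
    by simp⟩

theorem IsHermitianPPM.exists_eq (hh : IsHermitianPPM h) {c p q : V}
    (hind : LinearIndependent ℂ ![c, p, q]) (x : V) :
    ∃ r s t : ℂ, x = r • c + s • p + t • q := by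
  obtain ⟨b, rfl, rfl, rfl⟩ := hh.exists_basis hind
  refine ⟨b.repr x 0, b.repr x 1, b.repr x 2, ?_⟩
  conv_lhs => rw [← b.sum_repr x, Fin.sum_univ_three]

theorem IsHermitianPPM.end_ext (hh : IsHermitianPPM h) {c p q : V}
    (hind : LinearIndependent ℂ ![c, p, q]) {f g : Module.End ℂ V} (hc : f c = g c)
    (hp : f p = g p) (hq : f q = g q) : f = g := by
  ext x
  obtain ⟨r, s, t, rfl⟩ := hh.exists_eq hind x
  simp [hc, hp, hq]

theorem IsHermitianPPM.exists_eq_of_orthogonal (hh : IsHermitianPPM h) {c p q : V}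
    (hind : LinearIndependent ℂ ![c, p, q]) (hp : h p c = 0) (hq : h q c = 0) {w : V}
    (hw : h w c = 0) : ∃ x y : ℂ, w = x • p + y • q := by
  have hc : c ≠ 0 := hind.ne_zero 0
  have hcc : h c c ≠ 0 := by
    intro h0
    refine hc (hh.eq_zero_of_forall fun y => hh.eq_zero_comm ?_)
    obtain ⟨r, s, t, rfl⟩ := hh.exists_eq hind y
    simp [h0, hp, hq]
  obtain ⟨r, s, t, rfl⟩ := hh.exists_eq hind w
  have hr : r = 0 := by simpa [hp, hq, hcc] using hw
  exact ⟨s, t, by simp [hr]⟩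

theorem IsHermitianPPM.exists_eq_of_isPolar (hh : IsHermitianPPM h) {W : Submodule ℂ V}
    {c p q : V} (hind : LinearIndependent ℂ ![c, p, q]) (hc : IsPolar h W c)
    (hp : p ∈ W) (hq : q ∈ W) {w : V} (hw : w ∈ W) : ∃ x y : ℂ, w = x • p + y • q :=
  hh.exists_eq_of_orthogonal hind (hc.2 _ hp) (hc.2 _ hq) (hc.2 _ hw)

namespace IsSplit

variable {T : Module.End ℂ V} {W : Submodule ℂ V} {c : V} {γ : ℂ}
variable (hS : IsSplit h T W c γ) (hh : IsHermitianPPM h)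

include hS

theorem mul_conj : γ * conj γ = 1 := by
  have := hS.isometry c c
  rw [hS.apply_eq, form_smul_left, form_smul_right, ← mul_assoc] at this
  exact mul_right_cancel₀ hS.self_ne_zero (by rw [this, one_mul])

theorem apply_mem {x : V} (hx : x ∈ W) : T x ∈ W := by
  rw [hS.mem_iff] at hx ⊢
  have := hS.isometry x c
  rw [hx, hS.apply_eq, form_smul_right] at this
  exact (mul_eq_zero.mp this).resolve_left (right_ne_zero_of_mul_eq_one hS.mul_conj)

theorem sub_mem (x : V) : x - (h x c / h c c) • c ∈ W := by
  rw [hS.mem_iff, form_sub_left, form_smul_left, div_mul_cancel₀ _ hS.self_ne_zero, sub_self]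

theorem linearIndependent {p q : V} (hp : p ∈ W) (hq : q ∈ W)
    (hpq : LinearIndependent ℂ ![p, q]) : LinearIndependent ℂ ![c, p, q] := by
  refine linearIndependent_finCons.mpr ⟨hpq, fun hc => hS.self_ne_zero ?_⟩
  rw [← hS.mem_iff]
  refine Submodule.span_le.mpr ?_ hc
  rintro x ⟨i, rfl⟩
  fin_cases i
  · exact hp
  · exact hq

include hh

/-- Every vector of `V` differs from one of `W` by a multiple of `c`, so a radical vector of `W` is
radical in `V`. -/
theorem eq_zero {w : V} (hw : w ∈ W) (hw0 : ∀ y ∈ W, h w y = 0) : w = 0 := by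
  refine hh.eq_zero_of_forall fun y => ?_
  have := hw0 _ (hS.sub_mem y)
  rwa [form_sub_right, form_smul_right, (hS.mem_iff w).mp hw, mul_zero, sub_zero] at this

/-- A polar vector is a multiple of `c`, so the one used by a bending subgroup is as good as `c`. -/
theorem polar_apply {d : V} (hd : IsPolar h W d) : T d = γ • d := by
  have h0 : d - (h d c / h c c) • c = 0 := by
    refine hS.eq_zero hh (hS.sub_mem d) fun y hy => hh.eq_zero_comm ?_
    rw [form_sub_right, form_smul_right, hd.2 y hy, (hS.mem_iff y).mp hy, mul_zero, sub_zero]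
  rw [sub_eq_zero.mp h0, map_smul, hS.apply_eq, smul_comm]

theorem eigenvalues_ne {d p q : V} {μ ν : ℂ} (hind : LinearIndependent ℂ ![d, p, q])
    (hd : IsPolar h W d) (hp : p ∈ W) (hq : q ∈ W) (hTp : T p = μ • p) (hTq : T q = ν • q) :
    μ ≠ ν := by
  rintro rfl
  refine hS.not_scalar ⟨μ, fun w hw => ?_⟩
  obtain ⟨x, y, rfl⟩ := hh.exists_eq_of_isPolar hind hd hp hq hw
  rw [map_add, map_smul, map_smul, hTp, hTq]
  module

variable {b : ℝ → V ≃ₗ[ℂ] V} {u w : V}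

/-- `⟨u,u⟩` and `⟨T u,u⟩` combine `|x|²⟨p,p⟩` and `|y|²⟨q,q⟩` with weights `(1, 1)` and `(μ, ν)`. As
`μ ≠ ν`, they determine `|x|` and `|y|`. -/
theorem exists_bending_of_elliptic {d p q : V} {μ ν : ℂ} (hind : LinearIndependent ℂ ![d, p, q])
    (hd : IsPolar h W d) (hp : p ∈ W) (hq : q ∈ W) (hpq : h p q = 0) (hTp : T p = μ • p)
    (hTq : T q = ν • q) (hb : ∀ s : ℝ, b s p = Complex.exp (s / 2 * Complex.I) • p ∧
      b s q = Complex.exp (-(s / 2 * Complex.I)) • q)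
    (hu : u ∈ W) (hw : w ∈ W) (huw : h u u = h w w) (hTuw : h (T u) u = h (T w) w) :
    ∃ (s : ℝ) (z : ℂ), w = z • b s u := by
  have hne := hS.eigenvalues_ne hh hind hd hp hq hTp hTq
  have hqp := hh.eq_zero_comm hpq
  have hpp : h p p ≠ 0 := by
    intro h0
    refine hind.ne_zero 1 (hS.eq_zero hh hp fun y hy => ?_)
    obtain ⟨r, t, rfl⟩ := hh.exists_eq_of_isPolar hind hd hp hq hy
    simp [h0, hpq]
  have hqq : h q q ≠ 0 := by
    intro h0
    refine hind.ne_zero 2 (hS.eq_zero hh hq fun y hy => ?_)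
    obtain ⟨r, t, rfl⟩ := hh.exists_eq_of_isPolar hind hd hp hq hy
    simp [h0, hqp]
  obtain ⟨x, y, rfl⟩ := hh.exists_eq_of_isPolar hind hd hp hq hu
  obtain ⟨x', y', rfl⟩ := hh.exists_eq_of_isPolar hind hd hp hq hw
  simp only [T.map_add, T.map_smul, hTp, hTq, form_add_left, form_add_right, form_smul_left,
    form_smul_right, hpq, hqp] at huw hTuw
  have e1 : (μ - ν) * h p p * (x * conj x - x' * conj x') = 0 := by
    linear_combination hTuw - ν * huw
  have e2 : (μ - ν) * h q q * (y * conj y - y' * conj y') = 0 := by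
    linear_combination μ * huw - hTuw
  have e1' := (mul_eq_zero.mp e1).resolve_left (mul_ne_zero (sub_ne_zero.mpr hne) hpp)
  have e2' := (mul_eq_zero.mp e2).resolve_left (mul_ne_zero (sub_ne_zero.mpr hne) hqq)
  rw [Complex.mul_conj, Complex.mul_conj, sub_eq_zero] at e1' e2'
  obtain ⟨s, z, rfl, rfl⟩ := exists_phases (Complex.ofReal_inj.mp e1') (Complex.ofReal_inj.mp e2')
  refine ⟨s, z, ?_⟩
  rw [map_add, map_smul, map_smul, (hb s).1, (hb s).2]
  module

/-- The same elimination, now with the cross terms `x ȳ⟨p,q⟩` and `y x̄⟨q,p⟩`, determines `x ȳ`. It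
is nonzero because `u` is nonisotropic. -/
theorem exists_bending_of_loxodromic {d p q : V} {μ ν : ℂ}
    (hind : LinearIndependent ℂ ![d, p, q])
    (hd : IsPolar h W d) (hp : p ∈ W) (hq : q ∈ W) (hpp : h p p = 0) (hqq : h q q = 0)
    (hTp : T p = μ • p) (hTq : T q = ν • q)
    (hb : ∀ s : ℝ, b s p = Complex.exp s • p ∧ b s q = Complex.exp (-s) • q)
    (hu : u ∈ W) (hw : w ∈ W) (hu0 : h u u ≠ 0) (huw : h u u = h w w)
    (hTuw : h (T u) u = h (T w) w) :
    ∃ (s : ℝ) (z : ℂ), w = z • b s u := by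
  have hne := hS.eigenvalues_ne hh hind hd hp hq hTp hTq
  have hpq : h p q ≠ 0 := by
    intro h0
    refine hind.ne_zero 1 (hS.eq_zero hh hp fun y hy => ?_)
    obtain ⟨r, t, rfl⟩ := hh.exists_eq_of_isPolar hind hd hp hq hy
    simp [h0, hpp]
  obtain ⟨x, y, rfl⟩ := hh.exists_eq_of_isPolar hind hd hp hq hu
  obtain ⟨x', y', rfl⟩ := hh.exists_eq_of_isPolar hind hd hp hq hw
  simp only [T.map_add, T.map_smul, hTp, hTq, form_add_left, form_add_right, form_smul_left,
    form_smul_right, hpp, hqq] at huw hTuw hu0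
  have e1 : (μ - ν) * h p q * (x * conj y - x' * conj y') = 0 := by
    linear_combination hTuw - ν * huw
  have e1' := (mul_eq_zero.mp e1).resolve_left (mul_ne_zero (sub_ne_zero.mpr hne) hpq)
  have h0 : x * conj y ≠ 0 := by
    intro h0
    apply hu0
    rcases mul_eq_zero.mp h0 with h1 | h1
    · simp [h1]
    · simp [(map_eq_zero _).mp h1]
  obtain ⟨s, z, rfl, rfl⟩ := exists_scales (sub_eq_zero.mp e1') h0
  refine ⟨s, z, ?_⟩
  rw [map_add, map_smul, map_smul, (hb s).1, (hb s).2]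
  module

/-- `⟨T u,u⟩ - μ⟨u,u⟩ = a |y|²⟨p,q⟩` determines `|y|`, as `a ≠ 0` when `T` is not scalar on `W`;
then `⟨u,u⟩` determines `Re (x ȳ)`. -/
theorem exists_bending_of_parabolic {d p q : V} {μ a : ℂ} (hind : LinearIndependent ℂ ![d, p, q])
    (hd : IsPolar h W d) (hp : p ∈ W) (hq : q ∈ W) (hpp : h p p = 0) (hqq : h q q = 0)
    (hpq : h q p = h p q)
    (hTp : T p = μ • p) (hTq : T q = a • p + μ • q)
    (hb : ∀ s : ℝ, b s p = p ∧ b s q = ((s : ℂ) * Complex.I) • p + q)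
    (hu : u ∈ W) (hw : w ∈ W) (hu0 : h u u ≠ 0) (huw : h u u = h w w)
    (hTuw : h (T u) u = h (T w) w) :
    ∃ (s : ℝ) (z : ℂ), w = z • b s u := by
  have ha : a ≠ 0 := by
    rintro rfl
    exact hS.eigenvalues_ne hh hind hd hp hq hTp (by simpa using hTq) rfl
  have hpq0 : h p q ≠ 0 := by
    intro h0
    refine hind.ne_zero 1 (hS.eq_zero hh hp fun y hy => ?_)
    obtain ⟨r, t, rfl⟩ := hh.exists_eq_of_isPolar hind hd hp hq hy
    simp [h0, hpp]
  obtain ⟨x, y, rfl⟩ := hh.exists_eq_of_isPolar hind hd hp hq hu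
  obtain ⟨x', y', rfl⟩ := hh.exists_eq_of_isPolar hind hd hp hq hw
  simp only [T.map_add, T.map_smul, hTp, hTq, form_add_left, form_add_right, form_smul_left,
    form_smul_right, hpp, hqq, hpq] at huw hTuw hu0
  have e1 : a * h p q * (y * conj y - y' * conj y') = 0 := by
    linear_combination hTuw - μ * huw
  have e1' := (mul_eq_zero.mp e1).resolve_left (mul_ne_zero ha hpq0)
  rw [Complex.mul_conj, Complex.mul_conj, sub_eq_zero] at e1'
  have e2 : h p q * (x * conj y + y * conj x - (x' * conj y' + y' * conj x')) = 0 := by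
    linear_combination huw
  have e2' := sub_eq_zero.mp ((mul_eq_zero.mp e2).resolve_left hpq0)
  have hy0 : y ≠ 0 := by
    rintro rfl
    simp at hu0
  obtain ⟨s, z, rfl, rfl⟩ := exists_shear (Complex.ofReal_inj.mp e1') hy0 e2'
  refine ⟨s, z, ?_⟩
  rw [map_add, map_smul, map_smul, (hb s).1, (hb s).2]
  module

end IsSplit

end Split

/-! ### Construction of a bending subgroup and the type of `T`. -/

section Existence

variable {V : Type*} [AddCommGroup V] [Module ℂ V] {h : V →ₗ[ℂ] V →ₗ⋆[ℂ] ℂ}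

theorem sigma_mk (v : V) (hv : v ≠ 0) :
    sigma h (Projectivization.mk ℂ v hv) = SignType.sign (h v v).re := by
  obtain ⟨a, ha⟩ := Projectivization.exists_smul_eq_mk_rep ℂ v hv
  have hpos : 0 < Complex.normSq (a : ℂ) := Complex.normSq_pos.mpr a.ne_zero
  rw [sigma, ← ha, Units.smul_def, form_smul_left, form_smul_right, ← mul_assoc, Complex.mul_conj,
    Complex.re_ofReal_mul, sign_mul, sign_pos hpos, one_mul]

theorem isFixed_mk {T : Module.End ℂ V} {μ : ℂ} {v : V} (hv : v ≠ 0) (hT : T v = μ • v) :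
    IsFixed T (Projectivization.mk ℂ v hv) := by
  obtain ⟨a, ha⟩ := Projectivization.exists_smul_eq_mk_rep ℂ v hv
  refine ⟨μ, Module.End.mem_eigenspace_iff.mpr ?_, Projectivization.rep_nonzero _⟩
  rw [← ha, Units.smul_def, map_smul, hT, smul_comm]

theorem exists_hasEigenvector {T : Module.End ℂ V} {μ : ℂ} {v : V} (hv : v ≠ 0)
    (hT : T v = μ • v) : ∃ μ, T.HasEigenvector μ v :=
  ⟨μ, Module.End.mem_eigenspace_iff.mpr hT, hv⟩

theorem IsHermitianPPM.sigma_eq_zero_iff (hh : IsHermitianPPM h) (p : ℙ ℂ V) :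
    sigma h p = 0 ↔ h p.rep p.rep = 0 := by
  rw [sigma, sign_eq_zero_iff]
  exact ⟨fun h0 => Complex.ext h0 (hh.self_im _), fun h0 => by rw [h0, Complex.zero_re]⟩

theorem isometry_of_basis (b : Module.Basis (Fin 3) ℂ V) {f : Module.End ℂ V}
    (hf : ∀ i j, h (f (b i)) (f (b j)) = h (b i) (b j)) (x y : V) : h (f x) (f y) = h x y := by
  rw [← b.sum_repr x, ← b.sum_repr y]
  simp only [map_sum, LinearMap.sum_apply, f.map_smul, form_smul_left, form_smul_right, hf]

/-- A family of special isometries that is additive in the parameter is a one-parameter group. -/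
theorem exists_oneParameter {f : ℝ → Module.End ℂ V} (h0 : f 0 = 1)
    (hadd : ∀ s t, f (s + t) = f s * f t) (hiso : ∀ s x y, h (f s x) (f s y) = h x y)
    (hdet : ∀ s, LinearMap.det (f s) = 1) :
    ∃ B : Multiplicative ℝ →* SU h,
      ∀ s x, (B (Multiplicative.ofAdd s) : V ≃ₗ[ℂ] V) x = f s x := by
  let F : Multiplicative ℝ →* Module.End ℂ V :=
    { toFun := fun s => f s.toAdd, map_one' := h0, map_mul' := fun s t => hadd _ _ }
  let G : Multiplicative ℝ →* (V ≃ₗ[ℂ] V) :=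
    (LinearMap.GeneralLinearGroup.generalLinearEquiv ℂ V).toMonoidHom.comp F.toHomUnits
  exact ⟨G.codRestrict (SU h) fun s => ⟨hiso s.toAdd, hdet s.toAdd⟩, fun s x => rfl⟩

theorem exists_oneParameter_of_matrix (b : Module.Basis (Fin 3) ℂ V)
    {M : ℝ → Matrix (Fin 3) (Fin 3) ℂ} (h0 : M 0 = 1) (hadd : ∀ s t, M (s + t) = M s * M t)
    (hdet : ∀ s, (M s).det = 1)
    (hiso : ∀ s i j, h (∑ k, M s k i • b k) (∑ k, M s k j • b k) = h (b i) (b j)) :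
    ∃ B : Multiplicative ℝ →* SU h,
      ∀ s i, (B (Multiplicative.ofAdd s) : V ≃ₗ[ℂ] V) (b i) = ∑ k, M s k i • b k := by
  obtain ⟨B, hB⟩ := exists_oneParameter (h := h) (f := fun s => Matrix.toLin b b (M s))
    (by simp only [h0, Matrix.toLin_one]; rfl)
    (fun s t => by simp only [hadd, Matrix.toLin_mul b b b]; rfl)
    (fun s => isometry_of_basis b fun i j => by
      simp only [Matrix.toLin_self]
      exact hiso s i j)
    (fun s => by rw [LinearMap.det_toLin, hdet])
  exact ⟨B, fun s i => by rw [hB, Matrix.toLin_self]⟩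

/-- Serves both diagonal types: each invariance hypothesis holds either because the product of
characters is `1` or because the form entry vanishes. -/
theorem exists_diagonal_oneParameter (hh : IsHermitianPPM h) {c p q : V} {χ ψ : ℝ → ℂ}
    (hind : LinearIndependent ℂ ![c, p, q]) (hpc : h p c = 0) (hqc : h q c = 0)
    (hχ0 : χ 0 = 1) (hχ : ∀ s t, χ (s + t) = χ s * χ t) (hψ : ∀ s, χ s * ψ s = 1)
    (hpp : ∀ s, conj (χ s) * χ s * h p p = h p p) (hqq : ∀ s, conj (ψ s) * ψ s * h q q = h q q)
    (hpq : ∀ s, conj (ψ s) * χ s * h p q = h p q) :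
    ∃ B : Multiplicative ℝ →* SU h, ∀ s,
      (B (Multiplicative.ofAdd s) : V ≃ₗ[ℂ] V) c = c ∧
      (B (Multiplicative.ofAdd s) : V ≃ₗ[ℂ] V) p = χ s • p ∧
      (B (Multiplicative.ofAdd s) : V ≃ₗ[ℂ] V) q = ψ s • q := by
  obtain ⟨b, rfl, rfl, rfl⟩ := hh.exists_basis hind
  have hψ' : ∀ s, ψ s = (χ s)⁻¹ := fun s => eq_inv_of_mul_eq_one_right (hψ s)
  have hqp : ∀ s, conj (χ s) * ψ s * h (b 2) (b 1) = h (b 2) (b 1) := fun s => by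
    have := congrArg conj (hpq s)
    rw [map_mul, map_mul, Complex.conj_conj, hh.conj_symm] at this
    rw [mul_comm (conj _), this]
  have hcp := hh.eq_zero_comm hpc
  have hcq := hh.eq_zero_comm hqc
  obtain ⟨B, hB⟩ := exists_oneParameter_of_matrix (h := h) b
    (M := fun s => Matrix.diagonal ![1, χ s, ψ s])
    (by
      rw [← Matrix.diagonal_one, hψ', hχ0, inv_one]
      congr 1
      ext i
      fin_cases i <;> rfl)
    (fun s t => by
      rw [Matrix.diagonal_mul_diagonal, hψ', hψ', hψ', hχ, mul_inv]
      congr 1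
      ext i
      fin_cases i <;> simp)
    (fun s => by simp [Matrix.det_diagonal, Fin.prod_univ_three, hψ])
    (fun s i j => by
      simp only [Matrix.diagonal_apply, ite_smul, zero_smul, Finset.sum_ite_eq',
        Finset.mem_univ, if_true, form_smul_left, form_smul_right, ← mul_assoc]
      fin_cases i <;> fin_cases j <;> simp [hpc, hqc, hcp, hcq, hpp, hqq, hpq, hqp])
  refine ⟨B, fun s => ⟨?_, ?_, ?_⟩⟩ <;> simp [hB, Fin.sum_univ_three]

/-- In the norm of the image of `q` the cross terms are `i s⟨p,q⟩ - i s⟨q,p⟩`; they cancel because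
the pairing is real. -/
theorem exists_unipotent_oneParameter (hh : IsHermitianPPM h) {p q c : V}
    (hind : LinearIndependent ℂ ![p, q, c]) (hpc : h p c = 0) (hqc : h q c = 0)
    (hpp : h p p = 0) (hpq : h q p = h p q) :
    ∃ B : Multiplicative ℝ →* SU h, ∀ s : ℝ,
      (B (Multiplicative.ofAdd s) : V ≃ₗ[ℂ] V) p = p ∧
      (B (Multiplicative.ofAdd s) : V ≃ₗ[ℂ] V) q = ((s : ℂ) * Complex.I) • p + q ∧
      (B (Multiplicative.ofAdd s) : V ≃ₗ[ℂ] V) c = c := by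
  obtain ⟨b, rfl, rfl, rfl⟩ := hh.exists_basis hind
  have hcp := hh.eq_zero_comm hpc
  have hcq := hh.eq_zero_comm hqc
  obtain ⟨B, hB⟩ := exists_oneParameter_of_matrix (h := h) b
    (M := fun s => !![1, (s : ℂ) * Complex.I, 0; 0, 1, 0; 0, 0, 1])
    (by simp [Matrix.one_fin_three])
    (fun s t => by
      ext i j
      fin_cases i <;> fin_cases j <;> simp [Matrix.mul_apply, Fin.sum_univ_three]
      ring)
    (fun s => by simp [Matrix.det_fin_three])
    (fun s i j => by
      fin_cases i <;> fin_cases j <;>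
        simp [Fin.sum_univ_three, hpc, hqc, hcp, hcq, hpp, hpq])
  refine ⟨B, fun s => ⟨?_, ?_, ?_⟩⟩ <;> simp [hB, Fin.sum_univ_three]

theorem linearIndependent_rotate {c p q : V} (hind : LinearIndependent ℂ ![c, p, q]) :
    LinearIndependent ℂ ![p, q, c] := by
  have := hind.comp ![1, 2, 0] (by decide)
  convert this using 1
  ext i
  fin_cases i <;> rfl

namespace IsSplit

variable {T : Module.End ℂ V} {W : Submodule ℂ V} {c : V} {γ : ℂ}
variable (hS : IsSplit h T W c γ)

include hS

theorem isPolar : IsPolar h W c :=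
  ⟨fun h0 => hS.self_ne_zero (by simp [h0]), fun w => (hS.mem_iff w).mp⟩

theorem not_scalar_univ : ¬ ∃ μ : ℂ, T = μ • (1 : Module.End ℂ V) := by
  rintro ⟨μ, rfl⟩
  exact hS.not_scalar ⟨μ, fun w _ => rfl⟩

/-- If `T` has on `W` an isotropic eigenvector with a simple eigenvalue, then it has another one. -/
theorem isotropic_eigenvector {p q : V} {μ ν a : ℂ} (hqp : h q p ≠ 0) (hTp : T p = μ • p)
    (hTq : T q = a • p + ν • q) (hpp : h p p = 0) (hμν : μ ≠ ν) :
    T (q + (a / (ν - μ)) • p) = ν • (q + (a / (ν - μ)) • p) ∧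
      h (q + (a / (ν - μ)) • p) (q + (a / (ν - μ)) • p) = 0 := by
  have hne : ν - μ ≠ 0 := sub_ne_zero.mpr hμν.symm
  have hT : T (q + (a / (ν - μ)) • p) = ν • (q + (a / (ν - μ)) • p) := by
    rw [map_add, map_smul, hTp, hTq]
    match_scalars <;> field_simp
    ring
  refine ⟨hT, ?_⟩
  -- Pairing with `p` gives `ν μ̄ = 1`. Were the new eigenvector nonisotropic, `ν ν̄ = 1` would
  -- follow, hence `μ = ν`.
  have h1 : ν * conj μ = 1 := by
    have := hS.isometry q p
    rw [hTp, hTq, form_add_left, form_smul_left, form_smul_left, form_smul_right, form_smul_right,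
      hpp, mul_zero, mul_zero, zero_add, ← mul_assoc] at this
    exact mul_right_cancel₀ hqp (by rw [this, one_mul])
  by_contra hx
  have h2 := hS.isometry (q + (a / (ν - μ)) • p) (q + (a / (ν - μ)) • p)
  rw [hT, form_smul_left, form_smul_right, ← mul_assoc] at h2
  have h3 : ν * conj ν = 1 := mul_right_cancel₀ hx (by rw [h2, one_mul])
  rw [← h3] at h1
  have h4 := mul_left_cancel₀ (left_ne_zero_of_mul_eq_one h3) h1
  exact hμν ((starRingEnd ℂ).injective h4)

variable (hh : IsHermitianPPM h)
include hh

/-- The isotropic eigenvectors of `T` lie in `W`. -/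
theorem mem_of_isotropic {x : V} {μ : ℂ} (hx0 : x ≠ 0) (hx : h x x = 0) (hT : T x = μ • x) :
    x ∈ W := by
  rw [hS.mem_iff]
  -- A nonzero `c`-component forces `μ = γ`; then `x` is orthogonal to `W`, so it is a multiple of
  -- the nonisotropic `c`.
  by_contra hxc
  have hμ : μ * conj γ = 1 := by
    have := hS.isometry x c
    rw [hT, hS.apply_eq, form_smul_left, form_smul_right, ← mul_assoc] at this
    exact mul_right_cancel₀ hxc (by rw [this, one_mul])
  have hγ := hS.mul_conj
  rw [← hγ] at hμ
  have hμγ : μ = γ := mul_right_cancel₀ (right_ne_zero_of_mul_eq_one hγ) hμ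
  have h0 : x - (h x c / h c c) • c = 0 := by
    refine hS.eq_zero hh (hS.sub_mem x) fun y hy => ?_
    rw [form_sub_left, form_smul_left, hS.orthogonal x (hμγ ▸ hT) y hy,
      hh.eq_zero_comm ((hS.mem_iff y).mp hy), mul_zero, sub_zero]
  rw [sub_eq_zero] at h0
  rw [h0, form_smul_left, form_smul_right] at hx
  have hk : h x c / h c c = 0 := by simpa [hS.self_ne_zero] using hx
  exact hx0 (by rw [h0, hk, zero_smul])

theorem exists_eigenvector_mem : ∃ v ∈ W, v ≠ 0 ∧ ∃ μ : ℂ, T v = μ • v := by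
  have : Nontrivial W := by
    rw [Submodule.nontrivial_iff_ne_bot]
    rintro rfl
    refine hS.not_scalar ⟨0, fun w hw => ?_⟩
    rw [(Submodule.mem_bot ℂ).mp hw, map_zero, smul_zero]
  have := hh.finiteDimensional
  obtain ⟨μ, hμ⟩ := Module.End.exists_eigenvalue (T.restrict fun x hx => hS.apply_mem hx)
  obtain ⟨v, hv⟩ := hμ.exists_hasEigenvector
  exact ⟨v, v.2, fun h0 => hv.2 (Subtype.ext h0), μ, congrArg Subtype.val hv.apply_eq_smul⟩

/-- Isotropic fixed points lie in `W`, where distinct eigenvalues leave only the two eigenlines. -/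
theorem isLoxodromic {p q : V} {μ ν : ℂ} (hind : LinearIndependent ℂ ![c, p, q]) (hp : p ∈ W)
    (hq : q ∈ W) (hpp : h p p = 0) (hqq : h q q = 0) (hTp : T p = μ • p) (hTq : T q = ν • q) :
    IsLoxodromic h T := by
  have hne := hS.eigenvalues_ne hh hind hS.isPolar hp hq hTp hTq
  have hp0 : p ≠ 0 := hind.ne_zero 1
  have hq0 : q ≠ 0 := hind.ne_zero 2
  refine Set.encard_eq_two.mpr ⟨.mk ℂ p hp0, .mk ℂ q hq0, ?_, ?_⟩
  · intro he
    obtain ⟨t, ht⟩ := (Projectivization.mk_eq_mk_iff' ℂ p q hp0 hq0).mp he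
    have := congrArg T ht
    rw [map_smul, hTp, hTq, smul_comm, ht, ← sub_eq_zero, ← sub_smul] at this
    exact (sub_ne_zero.mpr hne.symm) ((smul_eq_zero.mp this).resolve_right hp0)
  · ext x
    constructor
    · rintro ⟨hx, l, hl⟩
      have hxx := (hh.sigma_eq_zero_iff x).mp hx
      have hTx := hl.apply_eq_smul
      have hxW := hS.mem_of_isotropic hh hl.2 hxx hTx
      obtain ⟨r, t, hrt⟩ := hh.exists_eq_of_isPolar hind hS.isPolar hp hq hxW
      have hsum : ((r * (μ - l)) • p + (t * (ν - l)) • q) = 0 := by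
        rw [hrt, map_add, map_smul, map_smul, hTp, hTq] at hTx
        linear_combination (norm := module) hTx
      have hcoef := LinearIndependent.pair_iff.mp (linearIndependent_finCons.mp hind).1 _ _ hsum
      rw [← x.mk_rep, Set.mem_insert_iff, Set.mem_singleton_iff, Projectivization.mk_eq_mk_iff',
        Projectivization.mk_eq_mk_iff', hrt]
      rcases mul_eq_zero.mp hcoef.1 with hr | hr
      · exact Or.inr ⟨t, by rw [hr, zero_smul, zero_add]⟩
      · rcases mul_eq_zero.mp hcoef.2 with ht | ht
        · exact Or.inl ⟨r, by rw [ht, zero_smul, add_zero]⟩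
        · exact absurd ((sub_eq_zero.mp hr).trans (sub_eq_zero.mp ht).symm) hne
    · rintro (rfl | rfl)
      · exact ⟨by rw [sigma_mk, hpp]; simp, isFixed_mk hp0 hTp⟩
      · exact ⟨by rw [sigma_mk, hqq]; simp, isFixed_mk hq0 hTq⟩

/-- Isotropic fixed points lie in `W`, where a nontrivial Jordan block has a single eigenline. -/
theorem isParabolic {p q : V} {μ a : ℂ} (hind : LinearIndependent ℂ ![c, p, q]) (hp : p ∈ W)
    (hq : q ∈ W) (hpp : h p p = 0) (hTp : T p = μ • p) (hTq : T q = a • p + μ • q) :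
    IsParabolic h T := by
  have hp0 : p ≠ 0 := hind.ne_zero 1
  have ha : a ≠ 0 := by
    rintro rfl
    exact hS.eigenvalues_ne hh hind hS.isPolar hp hq hTp (by simpa using hTq) rfl
  refine Set.encard_eq_one.mpr ⟨.mk ℂ p hp0, ?_⟩
  ext x
  constructor
  · rintro ⟨hx, l, hl⟩
    have hxx := (hh.sigma_eq_zero_iff x).mp hx
    have hTx := hl.apply_eq_smul
    have hxW := hS.mem_of_isotropic hh hl.2 hxx hTx
    obtain ⟨r, t, hrt⟩ := hh.exists_eq_of_isPolar hind hS.isPolar hp hq hxW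
    have hsum : ((r * (μ - l) + t * a) • p + (t * (μ - l)) • q) = 0 := by
      rw [hrt, map_add, map_smul, map_smul, hTp, hTq] at hTx
      linear_combination (norm := module) hTx
    have hcoef := LinearIndependent.pair_iff.mp (linearIndependent_finCons.mp hind).1 _ _ hsum
    have ht : t = 0 := by
      rcases mul_eq_zero.mp hcoef.2 with ht | ht
      · exact ht
      · have := hcoef.1
        rw [ht, mul_zero, zero_add] at this
        exact (mul_eq_zero.mp this).resolve_right ha
    rw [← x.mk_rep, Set.mem_singleton_iff, Projectivization.mk_eq_mk_iff', hrt]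
    exact ⟨r, by rw [ht, zero_smul, add_zero]⟩
  · rintro rfl
    exact ⟨by rw [sigma_mk, hpp]; simp, isFixed_mk hp0 hTp⟩

/-- In an orthogonal eigenbasis, one of the vectors (possibly `c`) must be negative, since the form
takes a negative value. -/
theorem isElliptic {p q : V} {μ ν : ℂ} (hind : LinearIndependent ℂ ![c, p, q]) (hp : p ∈ W)
    (hq : q ∈ W) (hpq : h p q = 0) (hTp : T p = μ • p) (hTq : T q = ν • q) :
    IsElliptic h T := by
  refine ⟨hS.not_scalar_univ, ?_⟩
  have key : ∀ (v : V) (l : ℂ), v ≠ 0 → T v = l • v → (h v v).re < 0 →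
      ∃ x : ℙ ℂ V, sigma h x = -1 ∧ IsFixed T x := fun v l hv hT hneg =>
    ⟨.mk ℂ v hv, by rw [sigma_mk, sign_neg hneg], isFixed_mk hv hT⟩
  by_contra hno
  have hc := not_lt.mp fun hneg => hno (key c γ (hind.ne_zero 0) hS.apply_eq hneg)
  have hp' := not_lt.mp fun hneg => hno (key p μ (hind.ne_zero 1) hTp hneg)
  have hq' := not_lt.mp fun hneg => hno (key q ν (hind.ne_zero 2) hTq hneg)
  obtain ⟨x, hx⟩ := hh.exists_neg
  obtain ⟨r, s, t, rfl⟩ := hh.exists_eq hind x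
  have hpc := (hS.mem_iff p).mp hp
  have hqc := (hS.mem_iff q).mp hq
  have e : h (r • c + s • p + t • q) (r • c + s • p + t • q) =
      (Complex.normSq r : ℂ) * h c c + Complex.normSq s * h p p + Complex.normSq t * h q q := by
    simp only [form_add_left, form_add_right, form_smul_left, form_smul_right, hpc, hqc, hpq,
      hh.eq_zero_comm hpc, hh.eq_zero_comm hqc, hh.eq_zero_comm hpq, ← Complex.mul_conj]
    ring
  rw [e, Complex.add_re, Complex.add_re, Complex.re_ofReal_mul, Complex.re_ofReal_mul,
    Complex.re_ofReal_mul] at hx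
  have h1 := mul_nonneg (Complex.normSq_nonneg r) hc
  have h2 := mul_nonneg (Complex.normSq_nonneg s) hp'
  have h3 := mul_nonneg (Complex.normSq_nonneg t) hq'
  linarith

theorem exists_bendingGroup_of_orthogonal {p q : V} {μ ν : ℂ}
    (hind : LinearIndependent ℂ ![c, p, q]) (hp : p ∈ W) (hq : q ∈ W) (hpq : h p q = 0)
    (hTp : T p = μ • p) (hTq : T q = ν • q) :
    ∃ B : Multiplicative ℝ →* SU h, IsBendingGroup h W T B := by
  have hexp : ∀ z : ℂ, conj z = -z → conj (Complex.exp z) * Complex.exp z = 1 := fun z hz => by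
    rw [← Complex.exp_conj, hz, ← Complex.exp_add, neg_add_cancel, Complex.exp_zero]
  obtain ⟨B, hB⟩ := exists_diagonal_oneParameter hh hind ((hS.mem_iff p).mp hp)
    ((hS.mem_iff q).mp hq) (χ := fun s => Complex.exp (s / 2 * Complex.I))
    (ψ := fun s => Complex.exp (-(s / 2 * Complex.I))) (by simp)
    (fun s t => by rw [← Complex.exp_add]; congr 1; push_cast; ring)
    (fun s => by rw [← Complex.exp_add, add_neg_cancel, Complex.exp_zero])
    (fun s => by rw [hexp _ (by simp [Complex.conj_ofNat]), one_mul])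
    (fun s => by rw [hexp _ (by simp [Complex.conj_ofNat]), one_mul])
    (fun s => by rw [hpq, mul_zero])
  exact ⟨B, Or.inl ⟨hS.isElliptic hh hind hp hq hpq hTp hTq, c, p, q, hind, hS.isPolar, hp, hq, hpq,
    exists_hasEigenvector (hind.ne_zero 1) hTp, exists_hasEigenvector (hind.ne_zero 2) hTq, hB⟩⟩

theorem exists_bendingGroup_of_isotropic {p q : V} {μ ν : ℂ}
    (hind : LinearIndependent ℂ ![c, p, q]) (hp : p ∈ W) (hq : q ∈ W) (hpp : h p p = 0)
    (hqq : h q q = 0) (hTp : T p = μ • p) (hTq : T q = ν • q) :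
    ∃ B : Multiplicative ℝ →* SU h, IsBendingGroup h W T B := by
  obtain ⟨B, hB⟩ := exists_diagonal_oneParameter hh hind ((hS.mem_iff p).mp hp)
    ((hS.mem_iff q).mp hq) (χ := fun s => Complex.exp s)
    (ψ := fun s => Complex.exp (-s)) (by simp)
    (fun s t => by rw [← Complex.exp_add]; congr 1; push_cast; ring)
    (fun s => by rw [← Complex.exp_add, add_neg_cancel, Complex.exp_zero])
    (fun s => by rw [hpp, mul_zero]) (fun s => by rw [hqq, mul_zero])
    (fun s => by
      rw [← Complex.exp_conj, ← Complex.exp_add, map_neg, Complex.conj_ofReal, neg_add_cancel,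
        Complex.exp_zero, one_mul])
  exact ⟨B, Or.inr (Or.inl ⟨hS.isLoxodromic hh hind hp hq hpp hqq hTp hTq, c, p, q, hind,
    hS.isPolar, hp, hq, hpp, hqq, exists_hasEigenvector (hind.ne_zero 1) hTp,
    exists_hasEigenvector (hind.ne_zero 2) hTq, hB⟩)⟩

theorem exists_bendingGroup_of_unipotent {p q : V} {μ a : ℂ}
    (hind : LinearIndependent ℂ ![c, p, q]) (hp : p ∈ W) (hq : q ∈ W) (hpp : h p p = 0)
    (hqq : h q q = 0) (hpq : h q p = h p q) (hTp : T p = μ • p) (hTq : T q = a • p + μ • q) :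
    ∃ B : Multiplicative ℝ →* SU h, IsBendingGroup h W T B := by
  have hind' := linearIndependent_rotate hind
  obtain ⟨B, hB⟩ := exists_unipotent_oneParameter hh hind' ((hS.mem_iff p).mp hp)
    ((hS.mem_iff q).mp hq) hpp hpq
  exact ⟨B, Or.inr (Or.inr ⟨hS.isParabolic hh hind hp hq hpp hTp hTq, p, q, c, hind',
    hS.isPolar, hp, hq, hpp, hqq, exists_hasEigenvector (hind.ne_zero 1) hTp, hB⟩)⟩

theorem exists_bendingGroup : ∃ B : Multiplicative ℝ →* SU h, IsBendingGroup h W T B := by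
  obtain ⟨v, hv, hv0, μ, hTv⟩ := hS.exists_eigenvector_mem hh
  by_cases hvv : h v v = 0
  · obtain ⟨w, hw, hvw⟩ : ∃ w ∈ W, h v w ≠ 0 := by
      by_contra hno
      push Not at hno
      exact hv0 (hS.eq_zero hh hv hno)
    have hwv : h w v ≠ 0 := fun h0 => hvw (hh.eq_zero_comm h0)
    obtain ⟨w₁, hw₁, hwv₁⟩ : ∃ w₁ ∈ W, h w₁ v = 1 :=
      ⟨(h w v)⁻¹ • w, W.smul_mem _ hw, by rw [form_smul_left, inv_mul_cancel₀ hwv]⟩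
    have hvw₁ : h v w₁ = 1 := by rw [← hh.conj_symm, hwv₁, map_one]
    obtain ⟨q, hq, hqv, hqq⟩ : ∃ q ∈ W, h q v = 1 ∧ h q q = 0 := by
      -- Subtracting half the norm along the isotropic `v` kills the norm and keeps the pairing with
      -- `v`.
      refine ⟨w₁ - (h w₁ w₁ / 2) • v, W.sub_mem hw₁ (W.smul_mem _ hv), ?_, ?_⟩
      · rw [form_sub_left, form_smul_left, hvv, hwv₁, mul_zero, sub_zero]
      · simp only [form_sub_left, form_sub_right, form_smul_left, form_smul_right, hvv, hwv₁, hvw₁,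
          map_div₀, hh.conj_symm, map_ofNat]
        ring
    have hvq : h v q = 1 := by rw [← hh.conj_symm, hqv, map_one]
    have hpair : LinearIndependent ℂ ![v, q] := by
      refine LinearIndependent.pair_iff.mpr fun s t hst => ?_
      have h1 := congrArg (fun x => h x v) hst
      have h2 := congrArg (fun x => h x q) hst
      simp only [form_add_left, form_smul_left, hvv, hqv, hvq, hqq, map_zero,
        LinearMap.zero_apply, mul_zero, mul_one, zero_add, add_zero] at h1 h2
      exact ⟨h2, h1⟩
    have hind := hS.linearIndependent hv hq hpair
    obtain ⟨a, ν, hTq⟩ := hh.exists_eq_of_isPolar hind hS.isPolar hv hq (hS.apply_mem hq)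
    by_cases hμν : μ = ν
    · subst hμν
      exact hS.exists_bendingGroup_of_unipotent hh hind hv hq hvv hqq (hqv.trans hvq.symm) hTv hTq
    · obtain ⟨hT, h0⟩ := hS.isotropic_eigenvector (by rw [hqv]; exact one_ne_zero) hTv hTq hvv hμν
      refine hS.exists_bendingGroup_of_isotropic hh (hS.linearIndependent hv ?_ ?_) hv ?_ hvv h0
        hTv hT
      · exact W.add_mem hq (W.smul_mem _ hv)
      · refine LinearIndependent.pair_iff.mpr fun s t hst => ?_
        have := LinearIndependent.pair_iff.mp hpair (s + t * (a / (ν - μ))) t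
          (by linear_combination (norm := module) hst)
        obtain ⟨h1, rfl⟩ := this
        exact ⟨by simpa using h1, rfl⟩
      · exact W.add_mem hq (W.smul_mem _ hv)
  · obtain ⟨w, hw, hwv⟩ : ∃ w ∈ W, ∀ t : ℂ, w ≠ t • v := by
      by_contra hno
      push Not at hno
      refine hS.not_scalar ⟨μ, fun w hw => ?_⟩
      obtain ⟨t, rfl⟩ := hno w hw
      rw [map_smul, hTv, smul_comm]
    obtain ⟨q, hq, hq0, hqv⟩ : ∃ q ∈ W, q ≠ 0 ∧ h q v = 0 :=
      ⟨w - (h w v / h v v) • v, W.sub_mem hw (W.smul_mem _ hv), fun h0 => hwv _ (sub_eq_zero.mp h0),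
        by rw [form_sub_left, form_smul_left, div_mul_cancel₀ _ hvv, sub_self]⟩
    have hind := hS.linearIndependent hv hq (LinearIndependent.pair_iff.mpr fun s t hst => by
      have h1 := congrArg (fun x => h x v) hst
      simp only [form_add_left, form_smul_left, hqv, map_zero, LinearMap.zero_apply, mul_zero,
        add_zero] at h1
      have hs := (mul_eq_zero.mp h1).resolve_right hvv
      refine ⟨hs, ?_⟩
      rw [hs, zero_smul, zero_add] at hst
      exact (smul_eq_zero.mp hst).resolve_right hq0)
    obtain ⟨a, ν, hTq⟩ := hh.exists_eq_of_isPolar hind hS.isPolar hv hq (hS.apply_mem hq)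
    -- The isometry `T` preserves the orthogonal complement of the nonisotropic eigenvector `v`.
    have ha : a = 0 := by
      have h1 := hS.isometry q v
      have h2 := hS.isometry v v
      rw [hTv, form_smul_left, form_smul_right, ← mul_assoc] at h2
      have hμ : μ * conj μ = 1 := mul_right_cancel₀ hvv (by rw [h2, one_mul])
      rw [hTq, hTv, form_smul_right, form_add_left, form_smul_left, form_smul_left, hqv, mul_zero,
        add_zero] at h1
      simpa [right_ne_zero_of_mul_eq_one hμ, hvv, left_ne_zero_of_mul_eq_one hμ] using h1
    exact hS.exists_bendingGroup_of_orthogonal hh hind hv hq (hh.eq_zero_comm hqv) hTv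
      (by rw [hTq, ha, zero_smul, zero_add])

end IsSplit

end Existence

/-! ### Bendings commute with `T`; equivariance of special elliptic isometries. -/

section Conjugation

variable {V : Type*} [AddCommGroup V] [Module ℂ V] {h : V →ₗ[ℂ] V →ₗ⋆[ℂ] ℂ}

namespace IsSplit

variable {T : Module.End ℂ V} {W : Submodule ℂ V} {c : V} {γ : ℂ}
variable (hS : IsSplit h T W c γ) (hh : IsHermitianPPM h)

include hS hh

/-- In the parabolic case `T` is unipotent on `W` up to a scalar. -/
theorem apply_eq_of_isParabolic (hT : IsParabolic h T) {d p q : V} {μ : ℂ}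
    (hind : LinearIndependent ℂ ![d, p, q]) (hd : IsPolar h W d) (hp : p ∈ W) (hq : q ∈ W)
    (hpp : h p p = 0) (hTp : T p = μ • p) : ∃ a : ℂ, T q = a • p + μ • q := by
  have hp0 : p ≠ 0 := hind.ne_zero 1
  have hpair := (linearIndependent_finCons.mp hind).1
  have hqp : h q p ≠ 0 := by
    intro h0
    refine hp0 (hS.eq_zero hh hp fun y hy => hh.eq_zero_comm ?_)
    obtain ⟨r, t, rfl⟩ := hh.exists_eq_of_isPolar hind hd hp hq hy
    simp [h0, hpp]
  obtain ⟨a, ν, hTq⟩ := hh.exists_eq_of_isPolar hind hd hp hq (hS.apply_mem hq)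
  by_cases hμν : μ = ν
  · exact ⟨a, by rw [hTq, hμν]⟩
  -- A simple eigenvalue would give a second isotropic fixed point, against parabolicity.
  exfalso
  obtain ⟨hTr, hrr⟩ := hS.isotropic_eigenvector hqp hTp hTq hpp hμν
  set r := q + (a / (ν - μ)) • p with hr
  have hind' : ∀ t : ℂ, t • p ≠ r := by
    intro t ht
    have := LinearIndependent.pair_iff.mp hpair (t - a / (ν - μ)) (-1)
      (by linear_combination (norm := module) ht)
    simp at this
  have hr0 : r ≠ 0 := fun h0 => hind' 0 (by rw [h0, zero_smul])
  obtain ⟨x, hx⟩ := Set.encard_eq_one.mp hT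
  have h1 : Projectivization.mk ℂ p hp0 = x := by
    rw [← Set.mem_singleton_iff, ← hx]
    exact ⟨by rw [sigma_mk, hpp]; simp, isFixed_mk hp0 hTp⟩
  have h2 : Projectivization.mk ℂ r hr0 = x := by
    rw [← Set.mem_singleton_iff, ← hx]
    exact ⟨by rw [sigma_mk, hrr]; simp, isFixed_mk hr0 hTr⟩
  obtain ⟨t, ht⟩ := (Projectivization.mk_eq_mk_iff' ℂ r p hr0 hp0).mp (h2.trans h1.symm)
  exact hind' t ht

/-- Bendings commute with `T` and act transitively on the vectors `u ∈ W` with given nonzero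
`⟨u, u⟩` and given `⟨T u, u⟩`, up to scalars. -/
theorem commute_and_exists_bending {B : Multiplicative ℝ →* SU h}
    (hB : IsBendingGroup h W T B) :
    (∀ s : ℝ, Commute ((B (Multiplicative.ofAdd s) : V ≃ₗ[ℂ] V) : Module.End ℂ V) T) ∧
      ∀ u ∈ W, ∀ w ∈ W, h u u ≠ 0 → h u u = h w w → h (T u) u = h (T w) w →
        ∃ (s : ℝ) (z : ℂ), w = z • (B (Multiplicative.ofAdd s) : V ≃ₗ[ℂ] V) u := by
  rcases hB with ⟨-, d, p, q, hind, hd, hp, hq, hpq, ⟨μ, hμ⟩, ⟨ν, hν⟩, hb⟩ |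
    ⟨-, d, p, q, hind, hd, hp, hq, hpp, hqq, ⟨μ, hμ⟩, ⟨ν, hν⟩, hb⟩ |
    ⟨hpar, p, q, d, hind, hd, hp, hq, hpp, hqq, ⟨μ, hμ⟩, hb⟩
  · have hTp := hμ.apply_eq_smul
    have hTq := hν.apply_eq_smul
    have hTd := hS.polar_apply hh hd
    refine ⟨fun s => hh.end_ext hind ?_ ?_ ?_, fun u hu w hw _ huw hTuw =>
      hS.exists_bending_of_elliptic hh hind hd hp hq hpq hTp hTq (fun s => (hb s).2) hu hw huw hTuw⟩
    · simp [hTd, (hb s).1]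
    · simp [hTp, (hb s).2.1, smul_smul, mul_comm]
    · simp [hTq, (hb s).2.2, smul_smul, mul_comm]
  · have hTp := hμ.apply_eq_smul
    have hTq := hν.apply_eq_smul
    have hTd := hS.polar_apply hh hd
    refine ⟨fun s => hh.end_ext hind ?_ ?_ ?_, fun u hu w hw hu0 huw hTuw =>
      hS.exists_bending_of_loxodromic hh hind hd hp hq hpp hqq hTp hTq (fun s => (hb s).2) hu hw hu0
        huw hTuw⟩
    · simp [hTd, (hb s).1]
    · simp [hTp, (hb s).2.1, smul_smul, mul_comm]
    · simp [hTq, (hb s).2.2, smul_smul, mul_comm]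
  · have hind' := linearIndependent_rotate (linearIndependent_rotate hind)
    have hTp := hμ.apply_eq_smul
    obtain ⟨a, hTq⟩ := hS.apply_eq_of_isParabolic hh hpar hind' hd hp hq hpp hTp
    have hTd := hS.polar_apply hh hd
    -- The definition of the bending subgroup does not demand a real pairing: it follows from `B(1)`
    -- preserving `⟨q,q⟩ = 0`.
    have hpq : h q p = h p q := by
      have := (B (Multiplicative.ofAdd 1)).2.1 q q
      rw [(hb 1).2.1, hqq] at this
      simp only [form_add_left, form_add_right, form_smul_left, form_smul_right, hpp, hqq, map_mul,
        Complex.conj_I, Complex.ofReal_one, map_one] at this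
      apply mul_left_cancel₀ Complex.I_ne_zero
      linear_combination -this
    refine ⟨fun s => hh.end_ext hind ?_ ?_ ?_, fun u hu w hw hu0 huw hTuw =>
      hS.exists_bending_of_parabolic hh hind' hd hp hq hpp hqq hpq hTp hTq
        (fun s => ⟨(hb s).1, (hb s).2.1⟩) hu hw hu0 huw hTuw⟩
    · simp [hTp, (hb s).1]
    · simp only [Module.End.mul_apply, LinearEquiv.coe_coe, hTq, map_add, map_smul, (hb s).1,
        (hb s).2.1, hTp]
      module
    · simp [hTd, (hb s).2.2]

end IsSplit

theorem SU_smul_mk (g : SU h) (v : V) (hv : v ≠ 0) :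
    g • Projectivization.mk ℂ v hv =
      Projectivization.mk ℂ ((g : V ≃ₗ[ℂ] V) v) ((g : V ≃ₗ[ℂ] V).map_ne_zero_iff.mpr hv) := rfl

theorem sigma_smul (g : SU h) (p : ℙ ℂ V) : sigma h (g • p) = sigma h p := by
  conv_lhs => rw [← p.mk_rep]
  rw [SU_smul_mk, sigma_mk, g.2.1, sigma]

/-- Conjugating by `g` moves the centre to `g p`, as the formula involves only the form, which `g`
preserves. -/
theorem R_smul_apply (g : SU h) (α : Circle) (p : ℙ ℂ V) (x : V) :
    R h α (g • p) ((g : V ≃ₗ[ℂ] V) x) = (g : V ≃ₗ[ℂ] V) (R h α p x) := by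
  conv_lhs => rw [← p.mk_rep]
  rw [SU_smul_mk, R_mk, R, specialEllipticVec_apply, specialEllipticVec_apply, g.2.1, g.2.1,
    map_add, map_smul, map_smul]

/-- Evaluated at `p`, both sides minus `α p` are multiples of the respective centres, and the one
for `p` is nonzero because `α³ ≠ 1`. -/
theorem R_injective {α : Circle} (hα : α ^ 3 ≠ 1) {p q : ℙ ℂ V} (hp : h p.rep p.rep ≠ 0)
    (hR : R h α p = R h α q) : p = q := by
  have e := LinearMap.congr_fun hR p.rep
  rw [R, R, specialEllipticVec_apply, specialEllipticVec_apply, div_self hp, mul_one,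
    add_left_inj, mul_smul] at e
  have e' := smul_right_injective V (inv_sq_sub_ne_zero hα) e
  rw [← p.mk_rep, ← q.mk_rep, Projectivization.mk_eq_mk_iff']
  exact ⟨_, e'.symm⟩

theorem IsHermitianPPM.R_surjective (hh : IsHermitianPPM h) (α : Circle) {p : ℙ ℂ V}
    (hp : h p.rep p.rep ≠ 0) : Function.Surjective (R h α p) := by
  have := hh.finiteDimensional
  rw [← LinearMap.injective_iff_surjective, injective_iff_map_eq_zero]
  intro x hx
  refine hh.eq_zero_of_forall fun y => ?_
  rw [← hh.specialEllipticVec_isometry (circle_mul_conj α) hp]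
  change h (R h α p x) _ = 0
  rw [hx, map_zero, LinearMap.zero_apply]

/-- Vectors of the same sign have positive multiples of the same norm. -/
theorem IsHermitianPPM.exists_rescale (hh : IsHermitianPPM h) {u w : V} (hu : h u u ≠ 0)
    (hs : SignType.sign (h u u).re = SignType.sign (h w w).re) :
    ∃ ρ : ℝ, ρ ≠ 0 ∧ h u u = (ρ : ℂ) * ρ * h w w := by
  have hu' : (h u u).re ≠ 0 := fun h0 => hu (Complex.ext h0 (hh.self_im u))
  have hpos : 0 < (h u u).re / (h w w).re := by
    rcases lt_or_gt_of_ne hu' with hn | hn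
    · rw [sign_neg hn, eq_comm, sign_eq_neg_one_iff] at hs
      exact div_pos_of_neg_of_neg hn hs
    · rw [sign_pos hn, eq_comm, sign_eq_one_iff] at hs
      exact div_pos hn hs
  have hw : (h w w).re ≠ 0 := fun h0 => by simp [h0] at hpos
  refine ⟨Real.sqrt ((h u u).re / (h w w).re), (Real.sqrt_pos.mpr hpos).ne', ?_⟩
  rw [← Complex.ofReal_mul, Real.mul_self_sqrt hpos.le, ← hh.ofReal_self_re u,
    ← hh.ofReal_self_re w, ← Complex.ofReal_mul, Complex.ofReal_re, Complex.ofReal_re,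
    div_mul_cancel₀ _ hw]

end Conjugation

end CHyp

/-! ### The main theorem. -/

theorem mainTheorem2 {V : Type*} [AddCommGroup V] [Module ℂ V]
    (h : V →ₗ[ℂ] V →ₗ⋆[ℂ] ℂ) (hh : CHyp.IsHermitianPPM h)
    (p₁ p₂ q₁ q₂ : ℙ ℂ V) (α₁ α₂ : Circle)
    (hα₁ : α₁ ^ 3 ≠ 1) (hα₂ : α₂ ^ 3 ≠ 1)
    (hp₁ : CHyp.sigma h p₁ ≠ 0) (hp₂ : CHyp.sigma h p₂ ≠ 0)
    (hq₁ : CHyp.sigma h q₁ ≠ 0) (hq₂ : CHyp.sigma h q₂ ≠ 0)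
    (hp : p₁ ≠ p₂) (hq : q₁ ≠ q₂)
    (hpo : ¬ CHyp.Orthogonal h p₁ p₂) (hqo : ¬ CHyp.Orthogonal h q₁ q₂)
    (hL : ¬ CHyp.IsEuclidean h (CHyp.line p₁ p₂))
    (hσ₁ : CHyp.sigma h p₁ = CHyp.sigma h q₁) (hσ₂ : CHyp.sigma h p₂ = CHyp.sigma h q₂)
    (hR : CHyp.R h α₂ p₂ * CHyp.R h α₁ p₁ = CHyp.R h α₂ q₂ * CHyp.R h α₁ q₁) :
    (∃ B : Multiplicative ℝ →* CHyp.SU h,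
      CHyp.IsBendingGroup h (CHyp.line p₁ p₂) (CHyp.R h α₂ p₂ * CHyp.R h α₁ p₁) B) ∧
    ∀ B : Multiplicative ℝ →* CHyp.SU h,
      CHyp.IsBendingGroup h (CHyp.line p₁ p₂) (CHyp.R h α₂ p₂ * CHyp.R h α₁ p₁) B →
      (∀ s : ℝ, Commute ((B (Multiplicative.ofAdd s) : V ≃ₗ[ℂ] V) : Module.End ℂ V)
        (CHyp.R h α₂ p₂ * CHyp.R h α₁ p₁)) ∧
      ∃ s : ℝ, B (Multiplicative.ofAdd s) • p₁ = q₁ ∧ B (Multiplicative.ofAdd s) • p₂ = q₂ := by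
  have hline : CHyp.line p₁ p₂ = Submodule.span ℂ {p₁.rep, p₂.rep} := by
    rw [CHyp.line, Projectivization.submodule_eq, Projectivization.submodule_eq,
      Submodule.span_insert]
  rw [hline] at hL ⊢
  rw [ne_eq, hh.sigma_eq_zero_iff] at hp₁ hp₂ hq₁ hq₂
  have hpi := Projectivization.linearIndependent_pair_iff_ne.mpr hp
  have hqi := Projectivization.linearIndependent_pair_iff_ne.mpr hq
  obtain ⟨c, hS⟩ : ∃ c, CHyp.IsSplit h (CHyp.R h α₂ p₂ * CHyp.R h α₁ p₁)
      (Submodule.span ℂ {p₁.rep, p₂.rep}) c ((α₁ : ℂ) * α₂) :=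
    CHyp.isSplit_mul hh hα₁ hα₂ hp₁ hp₂ hpi (fun h0 => hpo (hh.eq_zero_comm h0)) hL
  have hq₁W : q₁.rep ∈ Submodule.span ℂ {p₁.rep, p₂.rep} := by
    rw [hS.mem_iff]
    -- `c` is also an eigenvector of the second factorization, with the same eigenvalue `α₁α₂`, so
    -- it is orthogonal to `q₁`.
    refine hh.eq_zero_comm (CHyp.orthogonal_of_mul_apply_eq hα₁ hα₂ hq₁ hq₂ hqi ?_).1
    rw [← hS.apply_eq]
    exact (LinearMap.congr_fun hR c).symm
  have hform : h ((CHyp.R h α₂ p₂ * CHyp.R h α₁ p₁) p₁.rep) p₁.rep * h q₁.rep q₁.rep =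
      h ((CHyp.R h α₂ p₂ * CHyp.R h α₁ p₁) q₁.rep) q₁.rep * h p₁.rep p₁.rep :=
    CHyp.form_mul_apply_self_eq hh hα₁ hα₂ hp₁ hp₂ hq₁ hq₂ rfl hR
  set T : Module.End ℂ V := CHyp.R h α₂ p₂ * CHyp.R h α₁ p₁
  refine ⟨hS.exists_bendingGroup hh, fun B hB => ?_⟩
  obtain ⟨hcomm, hex⟩ := hS.commute_and_exists_bending hh hB
  refine ⟨hcomm, ?_⟩
  obtain ⟨ρ, hρ0, hρ⟩ := hh.exists_rescale hp₁ hσ₁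
  have hρ0' : (ρ : ℂ) ≠ 0 := by exact_mod_cast hρ0
  obtain ⟨s, z, hsz⟩ := hex p₁.rep (Submodule.subset_span (by simp)) ((ρ : ℂ) • q₁.rep)
    (Submodule.smul_mem _ _ hq₁W) hp₁
    (by rw [CHyp.form_smul_left, CHyp.form_smul_right, Complex.conj_ofReal, hρ, mul_assoc])
    (by
      rw [T.map_smul, CHyp.form_smul_left, CHyp.form_smul_right, Complex.conj_ofReal, ← mul_assoc]
      apply mul_right_cancel₀ hq₁
      rw [hform, hρ]
      ring)
  set g := B (Multiplicative.ofAdd s) with hg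
  have hg₁ : g • p₁ = q₁ := by
    rw [← p₁.mk_rep, ← q₁.mk_rep, CHyp.SU_smul_mk, eq_comm, Projectivization.mk_eq_mk_iff']
    exact ⟨(ρ : ℂ)⁻¹ * z, by rw [mul_smul, ← hsz, inv_smul_smul₀ hρ0']⟩
  refine ⟨s, hg₁, CHyp.R_injective (h := h) hα₂ ?_ ?_⟩
  · rw [ne_eq, ← hh.sigma_eq_zero_iff]
    rwa [← hh.sigma_eq_zero_iff, ← CHyp.sigma_smul g p₂] at hp₂
  -- With `y` the image of `g x` under the factor centred at `q₁`, both sides become `T (g x) = g (T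
  -- x)`; surjectivity of that factor lets it be cancelled.
  · ext y
    obtain ⟨x, rfl⟩ := hh.R_surjective α₁ hq₁ y
    obtain ⟨x, rfl⟩ := (g : V ≃ₗ[ℂ] V).surjective x
    have e₁ := LinearMap.congr_fun (hcomm s) x
    have e₂ := LinearMap.congr_fun hR ((g : V ≃ₗ[ℂ] V) x)
    simp only [Module.End.mul_apply] at e₂
    rw [← e₂]
    conv_lhs => rw [← hg₁, CHyp.R_smul_apply, CHyp.R_smul_apply]
    exact e₁
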